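/- Let $r\simeq 0.834$ and $s\simeq 0.651$ be the roots of $4r^8-36r^7-27r^6+162r^5+135r^4-88r^3-73r^2-14r+1$ in $(0.8335,0.8345)$ and of $89s^8+1344s^7+4008s^6-464s^5-2410s^4+176s^3+296s^2-96s+1$ in $(0.6505,0.6515)$. **Packings.** Consider a packing of the plane (a set of interior-disjoint circles) by circles of sizes (radii) in $\{1,r,s\}$. It is *saturated* if no further circle of size $s$ can be added. The *cell* of a circle is the set of points at least as close to it as to any other circle (distance to a circle = distance to its center minus its radius). An *FM-triangulation* of the packing is a face-to-face triangulation of the plane by nondegenerate triangles on the circle centers that is dual to the cells: for each triangle $T$, the cells of its three circles share a point, which is the center of a *support circle* of $T$ (a circle tangent to the three circles of $T$ and interior-disjoint from all the circles). A triangle is *tight* if its three circles are mutually tangent, and *$\varepsilon$-tight* if they are pairwise at distance at most $\varepsilon$. **Excess.** Let $E(T)=\delta\,\mathrm{area}(T)-\mathrm{cov}(T)$, where $\mathrm{cov}(T)$ is the area of the part of $T$ inside the circles centered on its vertices, and $\delta\simeq 0.9093$ is the density of the target packing, that is, the covered proportion of a primitive cell of this periodic compact packing; a primitive cell is made of four tight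 triangles with circles of sizes $1,r,s$, one with sizes $1,1,s$ and one with sizes $1,r,r$. **Potential.** Let $V_{abc}=V_{cba}$ ($a,b,c\in\{1,r,s\}$) be the unique solution of the following equations: $V_{cab}+V_{abc}+V_{bca}=E(\check T)$ for each of the ten tight triangles $\check T$ with circles of sizes $a,b,c$; $V_{aba}=0$ for $a\ne b$; $V_{1s1}+4V_{1sr}=0$, $2V_{1rr}+4V_{1rs}=0$, $V_{r1r}+2V_{11s}+4V_{r1s}=0$. Given constants $m_1,m_r,m_s$, the potential of a vertex $v$ of $T$, with a circle of size $q$ in $v$ and circles of sizes $x,y$ in the two other vertices, is $$U_v(T)=V_{xqy}+m_q\,|\widehat v(T)-\widehat v(\check T)|,$$ where $\check T$ is the tight triangle with the same circle sizes as $T$ and $\widehat v$ is the angle in $v$. Given real constants $l_{xy},q_{xy}$, the potential $U_e(T)$ of an edge $e$ of $T$ joining the centers of circles of sizes $x,y$ is $0$ if $e$ is shorter than $l_{xy}$, and $q_{xy}\,d_e(T)$ otherwise, where $d_e(T)$ is the signed distance to $e$ of the center of the support circle of $T$, positive if it is on the same side of $e$ as $T$. Let $U(T)$ be the sum of the three vertex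 potentials and of the three edge potentials of $T$. **Proposition.** Fix $m_1=0.12$ and $m_r=m_s=0.03$. Let $\varepsilon\le 0.0561906177650666$, and assume that $l_{xy}>x+y+\varepsilon$ for all $x,y\in\{1,r,s\}$. Then $E(T)\ge U(T)$ for every $\varepsilon$-tight triangle $T$ of an FM-triangulation of a saturated packing by circles of sizes $1$, $r$ and $s$. -/

import Mathlib

noncomputable section

namespace FM

open MeasureTheory Set

/-! ### The three sizes -/

/-- The polynomial that defines the medium size `r`. -/
def polyR (x : ℝ) : ℝ :=
  4 * x ^ 8 - 36 * x ^ 7 - 27 * x ^ 6 + 162 * x ^ 5 + 135 * x ^ 4 - 88 * x ^ 3 - 73 * x ^ 2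
    - 14 * x + 1

/-- The polynomial that defines the small size `s`. -/
def polyS (x : ℝ) : ℝ :=
  89 * x ^ 8 + 1344 * x ^ 7 + 4008 * x ^ 6 - 464 * x ^ 5 - 2410 * x ^ 4 + 176 * x ^ 3
    + 296 * x ^ 2 - 96 * x + 1

theorem existsUnique_r : ∃! x : ℝ, x ∈ Ioo (0.8335 : ℝ) 0.8345 ∧ polyR x = 0 := by
  have hc : Continuous polyR := by unfold polyR; fun_prop
  have hd : ∀ x ∈ interior (Icc (0.8335 : ℝ) 0.8345), 0 < deriv polyR x := by
    intro x hx
    rw [interior_Icc] at hx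
    have h : HasDerivAt polyR (4 * (8 * x ^ 7) - 36 * (7 * x ^ 6) - 27 * (6 * x ^ 5)
        + 162 * (5 * x ^ 4) + 135 * (4 * x ^ 3) - 88 * (3 * x ^ 2) - 73 * (2 * x) - 14) x := by
      have := ((((((((hasDerivAt_pow 8 x).const_mul 4).sub ((hasDerivAt_pow 7 x).const_mul 36)).sub
        ((hasDerivAt_pow 6 x).const_mul 27)).add ((hasDerivAt_pow 5 x).const_mul 162)).add
        ((hasDerivAt_pow 4 x).const_mul 135)).sub ((hasDerivAt_pow 3 x).const_mul 88)).sub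
        ((hasDerivAt_pow 2 x).const_mul 73)).sub ((hasDerivAt_id x).const_mul 14)
      have := this.add_const 1
      exact this.congr_deriv (by norm_num)
    rw [h.deriv]
    have hlo : ∀ n : ℕ, (0.8335 : ℝ) ^ n ≤ x ^ n := fun n =>
      pow_le_pow_left₀ (by norm_num) hx.1.le n
    have hup : ∀ n : ℕ, x ^ n ≤ (0.8345 : ℝ) ^ n := fun n =>
      pow_le_pow_left₀ (by linarith [hx.1]) hx.2.le n
    have h7 := hlo 7; have h6 := hup 6; have h5 := hup 5; have h4 := hlo 4; have h3 := hlo 3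
    have h2 := hup 2; have h1 := hx.2
    norm_num at h7 h6 h5 h4 h3 h2 h1
    linarith
  have hm : StrictMonoOn polyR (Icc (0.8335 : ℝ) 0.8345) :=
    strictMonoOn_of_deriv_pos (convex_Icc _ _) hc.continuousOn hd
  have hz : (0 : ℝ) ∈ Ioo (polyR 0.8335) (polyR 0.8345) := by
    constructor <;> norm_num [polyR]
  obtain ⟨x, hx, hx0⟩ := intermediate_value_Ioo (by norm_num) hc.continuousOn hz
  refine ⟨x, ⟨hx, hx0⟩, fun y hy => ?_⟩
  exact hm.injOn (Ioo_subset_Icc_self hy.1) (Ioo_subset_Icc_self hx) (hy.2.trans hx0.symm)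

theorem existsUnique_s : ∃! x : ℝ, x ∈ Ioo (0.6505 : ℝ) 0.6515 ∧ polyS x = 0 := by
  have hc : Continuous polyS := by unfold polyS; fun_prop
  have hd : ∀ x ∈ interior (Icc (0.6505 : ℝ) 0.6515), 0 < deriv polyS x := by
    intro x hx
    rw [interior_Icc] at hx
    have h : HasDerivAt polyS (89 * (8 * x ^ 7) + 1344 * (7 * x ^ 6) + 4008 * (6 * x ^ 5)
        - 464 * (5 * x ^ 4) - 2410 * (4 * x ^ 3) + 176 * (3 * x ^ 2) + 296 * (2 * x) - 96) x := by
      have := ((((((((hasDerivAt_pow 8 x).const_mul 89).add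
        ((hasDerivAt_pow 7 x).const_mul 1344)).add
        ((hasDerivAt_pow 6 x).const_mul 4008)).sub ((hasDerivAt_pow 5 x).const_mul 464)).sub
        ((hasDerivAt_pow 4 x).const_mul 2410)).add ((hasDerivAt_pow 3 x).const_mul 176)).add
        ((hasDerivAt_pow 2 x).const_mul 296)).sub ((hasDerivAt_id x).const_mul 96)
      have := this.add_const 1
      exact this.congr_deriv (by norm_num)
    rw [h.deriv]
    have hlo : ∀ n : ℕ, (0.6505 : ℝ) ^ n ≤ x ^ n := fun n =>
      pow_le_pow_left₀ (by norm_num) hx.1.le n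
    have hup : ∀ n : ℕ, x ^ n ≤ (0.6515 : ℝ) ^ n := fun n =>
      pow_le_pow_left₀ (by linarith [hx.1]) hx.2.le n
    have h7 := hlo 7; have h6 := hlo 6; have h5 := hlo 5; have h4 := hup 4; have h3 := hup 3
    have h2 := hlo 2; have h1 := hx.1; have h4' := hup 5; have h3' := hlo 3
    norm_num at h7 h6 h5 h4 h3 h2 h1 h4' h3'
    linarith
  have hm : StrictMonoOn polyS (Icc (0.6505 : ℝ) 0.6515) :=
    strictMonoOn_of_deriv_pos (convex_Icc _ _) hc.continuousOn hd
  have hz : (0 : ℝ) ∈ Ioo (polyS 0.6505) (polyS 0.6515) := by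
    constructor <;> norm_num [polyS]
  obtain ⟨x, hx, hx0⟩ := intermediate_value_Ioo (by norm_num) hc.continuousOn hz
  refine ⟨x, ⟨hx, hx0⟩, fun y hy => ?_⟩
  exact hm.injOn (Ioo_subset_Icc_self hy.1) (Ioo_subset_Icc_self hx) (hy.2.trans hx0.symm)

/-- The medium size `r ≃ 0.834`. -/
def r : ℝ := Classical.choose existsUnique_r.exists

/-- The small size `s ≃ 0.651`. -/
def s : ℝ := Classical.choose existsUnique_s.exists

/-- The three possible sizes of a circle. -/
inductive Size where
  | large
  | medium
  | small

namespace Size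

/-- The size (radius) itself: `1`, `r` or `s`. -/
def rad : Size → ℝ
  | large => 1
  | medium => r
  | small => s

/-- Position in the list `1, r, s`; it only serves to list each unordered triple of sizes once. -/
def rank : Size → ℕ
  | large => 0
  | medium => 1
  | small => 2

end Size

open Size

/-! ### Packings and FM-triangulations -/

/-- The Euclidean plane. -/
abbrev Plane := EuclideanSpace ℝ (Fin 2)

/-- A circle of size `1`, `r` or `s` in the plane. -/
structure Disc where
  center : Plane
  size : Size

/-- The radius of a circle. -/
def Disc.rad (D : Disc) : ℝ := D.size.rad

/-- A packing by circles of sizes `1`, `r` and `s`: a set of interior-disjoint circles. -/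
def IsPacking (P : Set Disc) : Prop :=
  P.Pairwise fun D D' => Disjoint (Metric.ball D.center D.rad) (Metric.ball D'.center D'.rad)

/-- No further circle of size `s` can be added: a circle of size `s` centred anywhere overlaps
the interior of a circle of `P`. -/
def IsSaturated (P : Set Disc) : Prop :=
  ∀ p : Plane, ∃ D ∈ P, ¬ Disjoint (Metric.ball p s) (Metric.ball D.center D.rad)

/-- The cell of `D` in `P`: the points that are at least as close to the circle `D` as to any other
circle of `P` (the distance to a circle is the distance to its centre minus its radius). -/
def cell (P : Set Disc) (D : Disc) : Set Plane :=
  {p | ∀ D' ∈ P, dist p D.center - D.rad ≤ dist p D'.center - D'.rad}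

/-- A triangle whose vertices are the centres of three circles. -/
abbrev Triangle := Fin 3 → Disc

/-- The `i`-th vertex of a triangle. -/
def vertex (T : Triangle) (i : Fin 3) : Plane := (T i).center

/-- The (filled) triangle. -/
def hull (T : Triangle) : Set Plane := convexHull ℝ (range (vertex T))

/-- `X` is the centre of a support circle of `T`: it belongs to the cells of the three
circles of `T`. Then the circle of centre `X` and radius `dist X (vertex T i) - (T i).rad`, which
does not depend on `i`, is tangent to the three circles of `T` and interior-disjoint from all the
circles of `P`. -/
def IsSupportCenter (P : Set Disc) (T : Triangle) (X : Plane) : Prop :=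
  ∀ i, X ∈ cell P (T i)

/-- `𝒯` is an FM-triangulation of `P`: a face-to-face triangulation of the plane by nondegenerate
triangles on the set of centres of the circles of `P`, which is dual to the partition into cells
(where more than three cells share a point, the dual polygon is triangulated arbitrarily). -/
structure IsFMTriangulation (P : Set Disc) (𝒯 : Set Triangle) : Prop where
  mem : ∀ T ∈ 𝒯, ∀ i, T i ∈ P
  vertices : ∀ D ∈ P, ∃ T ∈ 𝒯, ∃ i, T i = D
  nondegenerate : ∀ T ∈ 𝒯, AffineIndependent ℝ (vertex T)
  dual : ∀ T ∈ 𝒯, ∃ X, IsSupportCenter P T X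
  face_to_face : ∀ T ∈ 𝒯, ∀ T' ∈ 𝒯,
    hull T ∩ hull T' = convexHull ℝ (range (vertex T) ∩ range (vertex T'))
  cover : ⋃ T ∈ 𝒯, hull T = univ

/-- The circles of `T` are pairwise at distance at most `ε`. -/
def IsEpsTight (ε : ℝ) (T : Triangle) : Prop :=
  ∀ i j, i ≠ j → dist (vertex T i) (vertex T j) - (T i).rad - (T j).rad ≤ ε

/-! ### Area, covered area, tight triangles, density and excess -/

/-- The area of `T`. -/
def area (T : Triangle) : ℝ := volume.real (hull T)

/-- The area of `T` inside the circles centred on its vertices. -/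
def cov (T : Triangle) : ℝ :=
  volume.real (hull T ∩ ⋃ i, Metric.closedBall (vertex T i) (T i).rad)

/-- The angle of `T` at its `i`-th vertex. -/
def angle (T : Triangle) (i : Fin 3) : ℝ :=
  EuclideanGeometry.angle (vertex T (i + 1)) (vertex T i) (vertex T (i + 2))

/-- The tight triangle with circles of sizes `a`, `b`, `c`, with its first vertex at the origin and
its second one on the positive first coordinate axis: its edges have lengths
`a + b`, `a + c` and `b + c`. -/
def tightTriangle (a b c : Size) : Triangle :=
  let x := ((a.rad + b.rad) ^ 2 + (a.rad + c.rad) ^ 2 - (b.rad + c.rad) ^ 2)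
    / (2 * (a.rad + b.rad))
  ![⟨!₂[0, 0], a⟩, ⟨!₂[a.rad + b.rad, 0], b⟩, ⟨!₂[x, √((a.rad + c.rad) ^ 2 - x ^ 2)], c⟩]

/-- The density of the target packing, that is, the proportion of a primitive cell of this periodic
packing that is covered by the circles. Its FM-triangulation cuts a primitive cell into four
tight triangles with circles of sizes `1, r, s`, one with sizes `1, 1, s` and one with sizes
`1, r, r`. -/
def density : ℝ :=
  (4 * cov (tightTriangle large medium small) + cov (tightTriangle large large small)
      + cov (tightTriangle large medium medium))
    / (4 * area (tightTriangle large medium small) + area (tightTriangle large large small)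
      + area (tightTriangle large medium medium))

/-- The excess of a triangle. -/
def excess (T : Triangle) : ℝ := density * area T - cov T

/-! ### The potential -/

/-- The equations that determine the potentials `V a q b` in the vertices of the tight
triangles; `V a q b` is the potential in the centre of the circle of size `q` in the tight triangle
with circles of sizes `a`, `q`, `b`. -/
structure IsTightPotential (V : Size → Size → Size → ℝ) : Prop where
  symm : ∀ a q b, V a q b = V b q a
  /-- The potential of each of the ten tight triangles is its excess. -/
  tight : ∀ a b c : Size, a.rank ≤ b.rank → b.rank ≤ c.rank →
    V c a b + V a b c + V b c a = excess (tightTriangle a b c)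
  /-- The potential in the apex of an isosceles non-equilateral tight triangle is zero. -/
  apex : ∀ a b : Size, a ≠ b → V a b a = 0
  /-- The potentials sum to zero around a small circle of the target packing. -/
  around_small : V large small large + 4 * V large small medium = 0
  /-- The potentials sum to zero around a medium circle of the target packing. -/
  around_medium : 2 * V large medium medium + 4 * V large medium small = 0
  /-- The potentials sum to zero around a large circle of the target packing. -/
  around_large :
    V medium large medium + 2 * V large large small + 4 * V medium large small = 0

theorem cov_nonneg (T : Triangle) : 0 ≤ cov T := measureReal_nonneg

theorem area_nonneg (T : Triangle) : 0 ≤ area T := measureReal_nonneg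

theorem cov_le_area (T : Triangle) : cov T ≤ area T := by
  refine measureReal_mono inter_subset_left ?_
  have : Bornology.IsBounded (hull T) :=
    isBounded_convexHull.2 (finite_range _).isBounded
  exact this.measure_lt_top.ne

/-- The excesses over a primitive cell of the target packing sum to zero. -/
theorem excess_cell : 4 * excess (tightTriangle large medium small)
    + excess (tightTriangle large large small) + excess (tightTriangle large medium medium) = 0 := by
  unfold excess density
  generalize h₁ : tightTriangle large medium small = T₁
  generalize h₂ : tightTriangle large large small = T₂
  generalize h₃ : tightTriangle large medium medium = T₃
  have a₁ := cov_nonneg T₁; have b₁ := cov_le_area T₁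
  have a₂ := cov_nonneg T₂; have b₂ := cov_le_area T₂
  have a₃ := cov_nonneg T₃; have b₃ := cov_le_area T₃
  by_cases h : 4 * area T₁ + area T₂ + area T₃ = 0
  · rw [h]
    simp only [div_zero, zero_mul]
    linarith
  · field_simp
    ring

/-- The above equations have exactly one solution. -/
theorem existsUnique_tightPotential : ∃! V, IsTightPotential V := by
  have key := excess_cell
  refine ⟨fun a q b => match a, q, b with
    | large, large, large => excess (tightTriangle large large large) / 3
    | medium, medium, medium => excess (tightTriangle medium medium medium) / 3
    | small, small, small => excess (tightTriangle small small small) / 3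
    | large, large, medium => excess (tightTriangle large large medium) / 2
    | medium, large, large => excess (tightTriangle large large medium) / 2
    | large, large, small => excess (tightTriangle large large small) / 2
    | small, large, large => excess (tightTriangle large large small) / 2
    | large, medium, medium => excess (tightTriangle large medium medium) / 2
    | medium, medium, large => excess (tightTriangle large medium medium) / 2
    | medium, medium, small => excess (tightTriangle medium medium small) / 2
    | small, medium, medium => excess (tightTriangle medium medium small) / 2
    | large, small, small => excess (tightTriangle large small small) / 2
    | small, small, large => excess (tightTriangle large small small) / 2
    | medium, small, small => excess (tightTriangle medium small small) / 2
    | small, small, medium => excess (tightTriangle medium small small) / 2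
    | large, medium, small => - excess (tightTriangle large medium medium) / 4
    | small, medium, large => - excess (tightTriangle large medium medium) / 4
    | medium, large, small => - excess (tightTriangle large large small) / 4
    | small, large, medium => - excess (tightTriangle large large small) / 4
    | _, _, _ => 0, ?_, ?_⟩
  · constructor
    · intro a q b
      cases a <;> cases q <;> cases b <;> rfl
    · intro a b c hab hbc
      cases a <;> cases b <;> cases c <;> simp [rank] at hab hbc ⊢ <;> linarith
    · intro a b hab
      cases a <;> cases b <;> simp at hab ⊢
    all_goals simp
    all_goals ring
  · intro V hV
    have t := hV.tight
    have y := hV.symm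
    have z := hV.apex
    have c₁ := hV.around_small
    have c₂ := hV.around_medium
    have c₃ := hV.around_large
    funext a q b
    have t₁ := t large large large (by simp [rank]) (by simp [rank])
    have t₂ := t medium medium medium (by simp [rank]) (by simp [rank])
    have t₃ := t small small small (by simp [rank]) (by simp [rank])
    have t₄ := t large large medium (by simp [rank]) (by simp [rank])
    have t₅ := t large large small (by simp [rank]) (by simp [rank])
    have t₆ := t large medium medium (by simp [rank]) (by simp [rank])
    have t₇ := t medium medium small (by simp [rank]) (by simp [rank])
    have t₈ := t large small small (by simp [rank]) (by simp [rank])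
    have t₉ := t medium small small (by simp [rank]) (by simp [rank])
    have z₁ := z large medium (by simp)
    have z₂ := z large small (by simp)
    have z₃ := z medium large (by simp)
    have z₄ := z medium small (by simp)
    have z₅ := z small large (by simp)
    have z₆ := z small medium (by simp)
    have y₁ := y large large medium
    have y₂ := y large large small
    have y₃ := y large medium medium
    have y₄ := y medium medium small
    have y₅ := y large small small
    have y₆ := y medium small small
    have y₇ := y large medium small
    have y₈ := y large small medium
    have y₉ := y medium large small
    cases a <;> cases q <;> cases b <;> simp only <;> linarith

/-- The potentials `V a q b` in the vertices of the tight triangles. -/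
def tightPotential : Size → Size → Size → ℝ :=
  Classical.choose existsUnique_tightPotential.exists

/-- The vertex potential of `T` at its `i`-th vertex, for the constants `m`. The angle of `T` is
compared with that of the tight triangle with the same circle sizes. -/
def vertexPotential (m : Size → ℝ) (T : Triangle) (i : Fin 3) : ℝ :=
  tightPotential (T (i + 1)).size (T i).size (T (i + 2)).size
    + m (T i).size
      * |angle T i - angle (tightTriangle (T 0).size (T 1).size (T 2).size) i|

/-- The line through the edge of `T` opposite to its `i`-th vertex. -/
def edgeLine (T : Triangle) (i : Fin 3) : AffineSubspace ℝ Plane :=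
  line[ℝ, vertex T (i + 1), vertex T (i + 2)]

open Classical in
/-- The signed distance of `X` to the edge of `T` opposite to its `i`-th vertex, positive if `T`
and `X` are on the same side of this edge. -/
def signedDist (T : Triangle) (X : Plane) (i : Fin 3) : ℝ :=
  if (edgeLine T i).SSameSide (vertex T i) X then Metric.infDist X (edgeLine T i)
  else - Metric.infDist X (edgeLine T i)

open Classical in
/-- The edge potential of the edge of `T` opposite to its `i`-th vertex, for the thresholds `l` and
the coefficients `q`, where `X` is the centre of the support circle of `T`. -/
def edgePotential (l q : Size → Size → ℝ) (T : Triangle) (X : Plane) (i : Fin 3) : ℝ :=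
  if dist (vertex T (i + 1)) (vertex T (i + 2)) < l (T (i + 1)).size (T (i + 2)).size then 0
  else q (T (i + 1)).size (T (i + 2)).size * signedDist T X i

/-- The potential of `T`: the sum of its vertex potentials and of its edge potentials. -/
def potential (m : Size → ℝ) (l q : Size → Size → ℝ) (T : Triangle) (X : Plane) : ℝ :=
  ∑ i, vertexPotential m T i + ∑ i, edgePotential l q T X i

end FM

end

namespace FM

open MeasureTheory Set Size

/-! Every edge of an ε-tight triangle joining circles of sizes x, y has length at most x + y + ε,
below its threshold, so all edge potentials vanish. The constants V at the vertices add up to the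
excess of the tight triangle with the same sizes. It remains to show that the excess exceeds that of
the tight triangle by at least the sum of m times the absolute deviations of the angles.

The covered part of a nondegenerate triangle has area at most the sum of the sectors rad²/2 · angle
(`cov_le_sum`), with equality for a tight triangle (`cov_eq_sum_of_tight`). Hence `defect`, the
function δ · area − Σ w · angle of the three side lengths with w = rad²/2, bounds the excess from
below and equals it at the tight triangle. Each absolute value is ±1 times the deviation; with these
signs fixed, the angular penalty is absorbed into the weights, which become rad²/2 ± m. The claim is
now that, for these weights, `defect` does not decrease when the sides of the tight triangle are
lengthened to those of T.

This is monotonicity in each side separately (`defect_mono`). With S four times the area, the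
derivative in the side a is a (δ (b² + c² − a²) − 4 w₀) / (2S), plus contributions of the two
adjacent angles, which decrease as a grows because the triangle is not obtuse. So 4 w₀ ≤ δ (b² + c²
− a²) suffices. The bound δ ≥ 0.85 (`le_density`) is accurate enough to check this for all triples
of sizes (`weight_le`). -/

/-! ### Area of a triangle as half a determinant -/

/-- The determinant of two vectors of the plane. -/
noncomputable def cross (u w : Plane) : ℝ := u 0 * w 1 - u 1 * w 0

theorem mem_convexHull_triple {a b c x : Plane} :
    x ∈ convexHull ℝ {a, b, c} ↔
      ∃ α β : ℝ, 0 ≤ α ∧ 0 ≤ β ∧ α + β ≤ 1 ∧ x = a + (α • (b - a) + β • (c - a)) := by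
  constructor
  · intro hx
    refine convexHull_min (t := {x | ∃ α β : ℝ, 0 ≤ α ∧ 0 ≤ β ∧ α + β ≤ 1 ∧
      x = a + (α • (b - a) + β • (c - a))}) ?_ ?_ hx
    · rintro y (rfl | rfl | rfl)
      · exact ⟨0, 0, by simp⟩
      · exact ⟨1, 0, by simp⟩
      · exact ⟨0, 1, by simp⟩
    · rintro _ ⟨α, β, h1, h2, h3, rfl⟩ _ ⟨α', β', h1', h2', h3', rfl⟩ p t hp ht hpt
      refine ⟨p * α + t * α', p * β + t * β', by positivity, by positivity, ?_, ?_⟩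
      · nlinarith
      · have : p = 1 - t := by linarith
        subst this
        module
  · rintro ⟨α, β, h1, h2, h3, rfl⟩
    have hc := convex_convexHull ℝ ({a, b, c} : Set Plane)
    have := hc.sum_mem (t := Finset.univ) (w := ![1 - α - β, α, β]) (z := ![a, b, c])
      (by intro i _; fin_cases i <;> simp <;> linarith)
      (by simp [Fin.sum_univ_three]; ring)
      (by intro i _; apply subset_convexHull; fin_cases i <;> simp)
    convert this using 1
    simp only [Fin.sum_univ_three, Matrix.cons_val_zero, Matrix.cons_val_one, Matrix.cons_val]
    module

theorem hull_eq_convexHull (T : Triangle) (i : Fin 3) :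
    hull T = convexHull ℝ {vertex T i, vertex T (i + 1), vertex T (i + 2)} := by
  unfold hull
  congr 1
  ext x
  simp only [mem_range, mem_insert_iff, mem_singleton_iff, Fin.exists_fin_succ]
  fin_cases i <;> simp [eq_comm] <;> tauto

/-- The linear map that sends the canonical basis of the plane to `u`, `w`. -/
noncomputable def frame (u w : Plane) : Plane →ₗ[ℝ] Plane where
  toFun p := p 0 • u + p 1 • w
  map_add' p q := by simp only [PiLp.add_apply]; module
  map_smul' c p := by simp only [PiLp.smul_apply, smul_eq_mul, RingHom.id_apply]; module

theorem det_frame (u w : Plane) : LinearMap.det (frame u w) = cross u w := by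
  rw [← LinearMap.det_toMatrix (EuclideanSpace.basisFun (Fin 2) ℝ).toBasis, Matrix.det_fin_two]
  simp [LinearMap.toMatrix_apply, frame, cross]
  ring

theorem measurePreserving_coordinates :
    MeasurePreserving (fun p : Plane => (p 0, p 1)) volume (volume : Measure (ℝ × ℝ)) :=
  (volume_preserving_finTwoArrow ℝ).comp (PiLp.volume_preserving_ofLp (Fin 2))

theorem volume_standard_triangle :
    volume {p : ℝ × ℝ | 0 ≤ p.1 ∧ 0 ≤ p.2 ∧ p.1 + p.2 ≤ 1} = ENNReal.ofReal (1 / 2) := by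
  have hm : MeasurableSet {p : ℝ × ℝ | 0 ≤ p.1 ∧ 0 ≤ p.2 ∧ p.1 + p.2 ≤ 1} := by
    apply IsClosed.measurableSet
    exact (isClosed_le continuous_const continuous_fst).inter
      ((isClosed_le continuous_const continuous_snd).inter
        (isClosed_le (continuous_fst.add continuous_snd) continuous_const))
  rw [Measure.volume_eq_prod, Measure.prod_apply hm]
  have h : ∀ x : ℝ, volume (Prod.mk x ⁻¹' {p : ℝ × ℝ | 0 ≤ p.1 ∧ 0 ≤ p.2 ∧ p.1 + p.2 ≤ 1})
      = (Icc (0 : ℝ) 1).indicator (fun x => ENNReal.ofReal (1 - x)) x := by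
    intro x
    by_cases hx : 0 ≤ x
    · have : Prod.mk x ⁻¹' {p : ℝ × ℝ | 0 ≤ p.1 ∧ 0 ≤ p.2 ∧ p.1 + p.2 ≤ 1} = Icc 0 (1 - x) := by
        ext y
        simp only [mem_preimage, mem_ofPred_eq, mem_Icc, hx, true_and]
        constructor <;> rintro ⟨h1, h2⟩ <;> constructor <;> linarith
      rw [this, Real.volume_Icc, sub_zero]
      by_cases h1 : x ≤ 1
      · rw [indicator_of_mem (by exact ⟨hx, h1⟩)]
      · rw [indicator_of_notMem (by simp [h1]), ENNReal.ofReal_of_nonpos (by linarith)]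
    · have : Prod.mk x ⁻¹' {p : ℝ × ℝ | 0 ≤ p.1 ∧ 0 ≤ p.2 ∧ p.1 + p.2 ≤ 1} = ∅ := by
        ext y
        simp [hx]
      rw [this, indicator_of_notMem (by simp [hx]), measure_empty]
  simp_rw [h]
  rw [lintegral_indicator measurableSet_Icc, ← ofReal_integral_eq_lintegral_ofReal]
  · rw [integral_Icc_eq_integral_Ioc, ← intervalIntegral.integral_of_le zero_le_one]
    congr 1
    rw [intervalIntegral.integral_sub (by simp) (by simp)]
    norm_num
  · exact (continuous_const.sub continuous_id).continuousOn.integrableOn_Icc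
  · filter_upwards [ae_restrict_mem measurableSet_Icc] with x hx
    simpa using hx.2

/-- The triangle is a translate of the image of the standard triangle, of area 1/2, under a linear
map whose determinant is the cross product. -/
theorem volume_convexHull_triple (a b c : Plane) :
    volume.real (convexHull ℝ {a, b, c}) = |cross (b - a) (c - a)| / 2 := by
  have h : convexHull ℝ {a, b, c} = (fun x => a + x) '' (frame (b - a) (c - a) ''
      ((fun p : Plane => (p 0, p 1)) ⁻¹' {p : ℝ × ℝ | 0 ≤ p.1 ∧ 0 ≤ p.2 ∧ p.1 + p.2 ≤ 1})) := by
    ext x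
    rw [mem_convexHull_triple]
    constructor
    · rintro ⟨α, β, h1, h2, h3, rfl⟩
      exact ⟨_, ⟨!₂[α, β], by simpa using ⟨h1, h2, h3⟩, rfl⟩, by simp [frame]⟩
    · rintro ⟨_, ⟨p, ⟨h1, h2, h3⟩, rfl⟩, rfl⟩
      exact ⟨p 0, p 1, h1, h2, h3, rfl⟩
  have hm : MeasurableSet {p : ℝ × ℝ | 0 ≤ p.1 ∧ 0 ≤ p.2 ∧ p.1 + p.2 ≤ 1} := by
    apply IsClosed.measurableSet
    exact (isClosed_le continuous_const continuous_fst).inter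
      ((isClosed_le continuous_const continuous_snd).inter
        (isClosed_le (continuous_fst.add continuous_snd) continuous_const))
  rw [measureReal_def, h, image_add_left, measure_preimage_add, Measure.addHaar_image_linearMap,
    measurePreserving_coordinates.measure_preimage hm.nullMeasurableSet, volume_standard_triangle,
    det_frame, ENNReal.toReal_mul, ENNReal.toReal_ofReal (abs_nonneg _),
    ENNReal.toReal_ofReal (by norm_num)]
  ring

/-! ### Area of a circular sector -/

/-- The sector `0 ≤ arg z ≤ θ`, `‖z‖ < q`. -/
theorem volume_sector {θ q : ℝ} (h0 : 0 < θ) (hπ : θ < Real.pi) (hq : 0 ≤ q) :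
    volume {z : ℂ | 0 ≤ z.im ∧ 0 ≤ z.re * Real.sin θ - z.im * Real.cos θ ∧ ‖z‖ < q}
      = ENNReal.ofReal (q ^ 2 / 2 * θ) := by
  set S := {z : ℂ | 0 ≤ z.im ∧ 0 ≤ z.re * Real.sin θ - z.im * Real.cos θ ∧ ‖z‖ < q} with hS
  have hm : MeasurableSet S := by
    have h1 : MeasurableSet {z : ℂ | 0 ≤ z.im} :=
      measurableSet_le measurable_const Complex.measurable_im
    have h2 : MeasurableSet {z : ℂ | 0 ≤ z.re * Real.sin θ - z.im * Real.cos θ} :=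
      measurableSet_le measurable_const (by fun_prop)
    have h3 : MeasurableSet {z : ℂ | ‖z‖ < q} := measurableSet_lt measurable_norm measurable_const
    exact h1.inter (h2.inter h3)
  rw [← lintegral_indicator_one hm, ← Complex.lintegral_comp_polarCoord_symm]
  have hmem : ∀ p ∈ polarCoord.target, ENNReal.ofReal p.1 • S.indicator 1
      (Complex.polarCoord.symm p) = (Ioo 0 q ×ˢ Icc 0 θ).indicator
        (fun p : ℝ × ℝ => ENNReal.ofReal p.1) p := by
    rintro ⟨ρ, φ⟩ hp
    simp only [polarCoord_target, mem_prod, mem_Ioi, mem_Ioo] at hp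
    obtain ⟨hρ, hφ1, hφ2⟩ := hp
    have e1 : (Complex.polarCoord.symm (ρ, φ)).re = ρ * Real.cos φ := by
      simp [Complex.polarCoord_symm_apply, -Complex.ofReal_cos, -Complex.ofReal_sin]
    have e2 : (Complex.polarCoord.symm (ρ, φ)).im = ρ * Real.sin φ := by
      simp [Complex.polarCoord_symm_apply, -Complex.ofReal_cos, -Complex.ofReal_sin]
    have e3 : ‖Complex.polarCoord.symm (ρ, φ)‖ = ρ := by
      rw [Complex.norm_polarCoord_symm, abs_of_pos hρ]
    have key : Complex.polarCoord.symm (ρ, φ) ∈ S ↔ (ρ, φ) ∈ Ioo 0 q ×ˢ Icc 0 θ := by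
      simp only [hS, mem_ofPred_eq, e1, e2, e3, mem_prod, mem_Ioo, mem_Icc, hρ, true_and]
      have h1 : 0 ≤ ρ * Real.sin φ ↔ 0 ≤ φ := by
        rw [mul_nonneg_iff_of_pos_left hρ]
        constructor
        · intro h
          by_contra! h'
          exact absurd h (not_le.2 (Real.sin_neg_of_neg_of_neg_pi_lt h' hφ1))
        · intro h
          exact Real.sin_nonneg_of_nonneg_of_le_pi h hφ2.le
      -- The second half-plane condition is ρ sin (θ − φ) ≥ 0; together with φ ≥ 0 it says φ ≤ θ,
      -- since θ − φ stays in (−π, π).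
      have h2 : 0 ≤ ρ * Real.cos φ * Real.sin θ - ρ * Real.sin φ * Real.cos θ
          ↔ 0 ≤ Real.sin (θ - φ) := by
        rw [← mul_nonneg_iff_of_pos_left hρ (b := Real.sin (θ - φ)), Real.sin_sub]
        ring_nf
      rw [h1, h2]
      constructor
      · rintro ⟨h3, h4, h5⟩
        refine ⟨h5, h3, ?_⟩
        by_contra! h'
        exact absurd h4 (not_le.2 (Real.sin_neg_of_neg_of_neg_pi_lt (by linarith) (by linarith)))
      · rintro ⟨h5, h3, h4⟩
        exact ⟨h3, Real.sin_nonneg_of_nonneg_of_le_pi (by linarith) (by linarith), h5⟩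
    by_cases hk : Complex.polarCoord.symm (ρ, φ) ∈ S
    · rw [indicator_of_mem hk, indicator_of_mem (key.1 hk)]
      simp
    · rw [indicator_of_notMem hk, indicator_of_notMem (fun h => hk (key.2 h))]
      simp
  rw [setLIntegral_congr_fun polarCoord.open_target.measurableSet hmem,
    lintegral_indicator (measurableSet_Ioo.prod measurableSet_Icc),
    Measure.restrict_restrict (measurableSet_Ioo.prod measurableSet_Icc)]
  have hsub : (Ioo 0 q ×ˢ Icc 0 θ) ∩ polarCoord.target = Ioo 0 q ×ˢ Icc 0 θ := by
    rw [inter_eq_left, polarCoord_target]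
    exact prod_mono (fun x hx => hx.1)
      (fun x hx => ⟨by linarith [hx.1, Real.pi_pos], by linarith [hx.2]⟩)
  rw [hsub, Measure.volume_eq_prod, ← Measure.prod_restrict]
  have := lintegral_prod_mul (μ := volume.restrict (Ioo 0 q)) (ν := volume.restrict (Icc 0 θ))
    (f := fun x => ENNReal.ofReal x) (g := fun _ => 1) (by fun_prop) (by fun_prop)
  simp only [mul_one] at this
  have hI : IntegrableOn (fun x : ℝ => x) (Ioo 0 q) :=
    continuous_id.continuousOn.integrableOn_Icc.mono_set Ioo_subset_Icc_self
  rw [this, ← ofReal_integral_eq_lintegral_ofReal hI, ← integral_Ioc_eq_integral_Ioo,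
    ← intervalIntegral.integral_of_le hq, integral_id, setLIntegral_one, Real.volume_Icc,
    ← ENNReal.ofReal_mul (by nlinarith [sq_nonneg q])]
  · congr 1
    ring
  · filter_upwards [ae_restrict_mem measurableSet_Ioo] with x hx
    exact hx.1.le

/-- Lagrange's identity: it makes the squared determinant invariant under isometries and expresses
the area through lengths. -/
theorem cross_sq (u w : Plane) :
    cross u w ^ 2 = ‖u‖ ^ 2 * ‖w‖ ^ 2 - (inner ℝ u w) ^ 2 := by
  rw [EuclideanSpace.norm_sq_eq, EuclideanSpace.norm_sq_eq]
  simp [cross, PiLp.inner_apply, Fin.sum_univ_two]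
  ring

/-- The cone spanned by `u` and `w`. -/
def cone (u w : Plane) : Set Plane := {p | ∃ α β : ℝ, 0 ≤ α ∧ 0 ≤ β ∧ p = α • u + β • w}

/-- Two independent vectors of the plane can be moved by an isometry to a position where the first
is a positive real number and the second is in the upper half-plane. -/
theorem exists_isometry_normal_position {u w : Plane} (h : cross u w ≠ 0) :
    ∃ g : Plane ≃ₗᵢ[ℝ] ℂ, g u = (‖u‖ : ℂ) ∧ 0 < (g w).im := by
  have hu : u ≠ 0 := by
    rintro rfl
    simp [cross] at h
  let g₀ : Plane ≃ₗᵢ[ℝ] ℂ := Complex.orthonormalBasisOneI.repr.symm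
  have hg0 : g₀ u ≠ 0 := by simpa using hu
  let g₁ : Plane ≃ₗᵢ[ℝ] ℂ := g₀.trans (rotation (Circle.exp (-(g₀ u).arg)))
  have h1 : g₁ u = (‖u‖ : ℂ) := by
    simp only [g₁, LinearIsometryEquiv.trans_apply, rotation_apply, Circle.coe_exp]
    have e := Complex.norm_mul_exp_arg_mul_I (g₀ u)
    rw [g₀.norm_map] at e
    generalize (g₀ u).arg = t at e ⊢
    rw [← e, mul_left_comm, ← Complex.exp_add]
    simp
  have h2 : (g₁ w).im ≠ 0 := by
    intro h0
    apply h
    rw [← sq_eq_zero_iff, cross_sq, ← g₁.norm_map w, ← g₁.inner_map_map, h1,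
      ← Complex.normSq_eq_norm_sq, Complex.normSq_apply, h0]
    simp
    ring
  -- If the rotation leaves w in the lower half-plane, complex conjugation repairs this and fixes
  -- the real image of u.
  rcases lt_or_gt_of_ne h2 with h3 | h3
  · exact ⟨g₁.trans Complex.conjLIE, by simp [h1], by simpa using h3⟩
  · exact ⟨g₁, h1, h3⟩

/-- A measure-preserving isometry carries the cone to the region between the positive real axis and
the ray of argument θ, the angle between the two vectors, so the sector formula applies. -/
theorem volume_cone_inter_ball {u w : Plane} (h : cross u w ≠ 0) {q : ℝ} (hq : 0 ≤ q) :
    volume (cone u w ∩ Metric.ball 0 q)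
      = ENNReal.ofReal (q ^ 2 / 2 * InnerProductGeometry.angle u w) := by
  obtain ⟨g, hgu, hgw⟩ := exists_isometry_normal_position h
  have hu : 0 < ‖u‖ := by
    rw [norm_pos_iff]
    rintro rfl
    simp [cross] at h
  have hw : g w ≠ 0 := by
    intro h0
    simp [h0] at hgw
  set θ := (g w).arg with hθ
  have hθ0 : 0 < θ := by
    have h1 : 0 ≤ θ := Complex.arg_nonneg_iff.2 hgw.le
    refine lt_of_le_of_ne h1 fun h2 => ?_
    exact hgw.ne' (Complex.arg_eq_zero_iff.1 h2.symm).2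
  have hθπ : θ < Real.pi := Complex.arg_lt_pi_iff.2 (Or.inr hgw.ne')
  have hang : InnerProductGeometry.angle u w = θ := by
    have e : InnerProductGeometry.angle (g w) (g u) = InnerProductGeometry.angle w u :=
      g.toLinearIsometry.angle_map w u
    rw [InnerProductGeometry.angle_comm, ← e, hgu,
      Complex.angle_eq_abs_arg hw (Complex.ofReal_ne_zero.2 hu.ne'), div_eq_mul_inv,
      ← Complex.ofReal_inv, Complex.arg_mul_real (inv_pos.2 hu), abs_of_pos hθ0]
  have hre : (g w).re = ‖g w‖ * Real.cos θ := by rw [hθ, Complex.norm_mul_cos_arg]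
  have him : (g w).im = ‖g w‖ * Real.sin θ := by rw [hθ, Complex.norm_mul_sin_arg]
  have hsin : 0 < Real.sin θ := Real.sin_pos_of_pos_of_lt_pi hθ0 hθπ
  have hset : cone u w ∩ Metric.ball 0 q
      = g ⁻¹' {z : ℂ | 0 ≤ z.im ∧ 0 ≤ z.re * Real.sin θ - z.im * Real.cos θ ∧ ‖z‖ < q} := by
    ext p
    simp only [cone, mem_inter_iff, mem_ofPred_eq, mem_ball_zero_iff, mem_preimage,
      LinearIsometryEquiv.norm_map, ← and_assoc, and_congr_left_iff]
    intro _
    constructor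
    · rintro ⟨α, β, ⟨hα, hβ⟩, rfl⟩
      have e1 : (g (α • u + β • w)).re = α * ‖u‖ + β * (g w).re := by simp [hgu]
      have e2 : (g (α • u + β • w)).im = β * (g w).im := by simp [hgu]
      rw [e1, e2, hre, him]
      refine ⟨by positivity, ?_⟩
      have : 0 ≤ α * ‖u‖ * Real.sin θ := by positivity
      linarith
    · rintro ⟨h1, h2⟩
      -- Coordinates of g p in the basis formed by the images of u and w, by Cramer's rule.
      refine ⟨((g p).re * Real.sin θ - (g p).im * Real.cos θ) / (‖u‖ * Real.sin θ),
        (g p).im / (g w).im, ⟨by positivity, by positivity⟩, ?_⟩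
      apply g.injective
      rw [map_add, map_smul, map_smul, hgu]
      apply Complex.ext
      · rw [Complex.add_re, Complex.smul_re, Complex.smul_re, Complex.ofReal_re, smul_eq_mul,
          smul_eq_mul, hre, him]
        field_simp
        ring
      · rw [Complex.add_im, Complex.smul_im, Complex.smul_im, Complex.ofReal_im, smul_eq_mul,
          smul_eq_mul, mul_zero, zero_add, div_mul_cancel₀ _ hgw.ne']
  have hm : MeasurableSet
      {z : ℂ | 0 ≤ z.im ∧ 0 ≤ z.re * Real.sin θ - z.im * Real.cos θ ∧ ‖z‖ < q} := by
    have h1 : MeasurableSet {z : ℂ | 0 ≤ z.im} :=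
      measurableSet_le measurable_const Complex.measurable_im
    have h2 : MeasurableSet {z : ℂ | 0 ≤ z.re * Real.sin θ - z.im * Real.cos θ} :=
      measurableSet_le measurable_const (by fun_prop)
    have h3 : MeasurableSet {z : ℂ | ‖z‖ < q} := measurableSet_lt measurable_norm measurable_const
    exact h1.inter (h2.inter h3)
  rw [hset, g.measurePreserving.measure_preimage hm.nullMeasurableSet,
    volume_sector hθ0 hθπ hq, hang]

/-! ### Angles and area in terms of the side lengths -/

/-- The length of the edge of `T` opposite to its `i`-th vertex. -/
noncomputable def edge (T : Triangle) (i : Fin 3) : ℝ := dist (vertex T (i + 1)) (vertex T (i + 2))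

/-- The angle opposite to the side `a` in a triangle with sides `a`, `b`, `c`. -/
noncomputable def ang (a b c : ℝ) : ℝ := Real.arccos ((b ^ 2 + c ^ 2 - a ^ 2) / (2 * b * c))

/-- The area of a triangle with sides `a`, `b`, `c`. -/
noncomputable def ar (a b c : ℝ) : ℝ :=
  √(4 * b ^ 2 * c ^ 2 - (b ^ 2 + c ^ 2 - a ^ 2) ^ 2) / 4

/-- Twice the signed area of `T`, computed from its `i`-th vertex. -/
noncomputable def crossAt (T : Triangle) (i : Fin 3) : ℝ :=
  cross (vertex T (i + 1) - vertex T i) (vertex T (i + 2) - vertex T i)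

theorem crossAt_eq (T : Triangle) (i : Fin 3) : crossAt T i = crossAt T 0 := by
  fin_cases i
  · rfl
  all_goals
    simp only [crossAt, cross, PiLp.sub_apply, Fin.isValue, Fin.mk_one, Fin.reduceFinMk,
      Fin.reduceAdd, zero_add]
    ring

theorem edge_eq_norm (T : Triangle) (i : Fin 3) :
    edge T i = ‖(vertex T (i + 1) - vertex T i) - (vertex T (i + 2) - vertex T i)‖ ∧
      edge T (i + 1) = ‖vertex T (i + 2) - vertex T i‖ ∧
      edge T (i + 2) = ‖vertex T (i + 1) - vertex T i‖ := by
  have h1 : i + 1 + 1 = i + 2 := by fin_cases i <;> rfl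
  have h2 : i + 1 + 2 = i := by fin_cases i <;> rfl
  have h3 : i + 2 + 1 = i := by fin_cases i <;> rfl
  have h4 : i + 2 + 2 = i + 1 := by fin_cases i <;> rfl
  refine ⟨by rw [sub_sub_sub_cancel_right, edge, dist_eq_norm], ?_, ?_⟩
  · rw [edge, h1, h2, dist_eq_norm]
  · rw [edge, h3, h4, dist_comm, dist_eq_norm]

theorem angle_eq_ang (T : Triangle) (i : Fin 3) :
    angle T i = ang (edge T i) (edge T (i + 1)) (edge T (i + 2)) := by
  obtain ⟨h1, h2, h3⟩ := edge_eq_norm T i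
  rw [h1, h2, h3, ang, angle, EuclideanGeometry.angle, InnerProductGeometry.angle, vsub_eq_sub,
    vsub_eq_sub, real_inner_eq_norm_mul_self_add_norm_mul_self_sub_norm_sub_mul_self_div_two]
  congr 1
  rw [div_div, ← sq, ← sq, ← sq]
  ring_nf

theorem area_eq_ar (T : Triangle) : area T = ar (edge T 0) (edge T 1) (edge T 2) := by
  obtain ⟨h1, h2, h3⟩ := edge_eq_norm T 0
  rw [zero_add] at h1 h2 h3
  rw [zero_add] at h1 h2 h3
  have hc := cross_sq (vertex T 1 - vertex T 0) (vertex T 2 - vertex T 0)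
  rw [real_inner_eq_norm_mul_self_add_norm_mul_self_sub_norm_sub_mul_self_div_two] at hc
  rw [h1, h2, h3, ar, area, hull_eq_convexHull T 0, volume_convexHull_triple, zero_add, zero_add,
    ← Real.sqrt_sq_eq_abs, hc, show ∀ x : ℝ, √x / 2 = 2 * √x / 4 by intro x; ring]
  congr 1
  rw [← Real.sqrt_sq (show (0 : ℝ) ≤ 2 by norm_num), ← Real.sqrt_mul (by norm_num)]
  congr 1
  rw [Real.sqrt_sq (by norm_num)]
  ring

/-! ### Covered area and sectors -/

/-- The triangle lies in the cone at its vertex, and the boundary circle is negligible. This is only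
an upper bound, since the disc may cross the opposite edge. -/
theorem volume_hull_inter_closedBall_le (T : Triangle) (hT : crossAt T 0 ≠ 0) (i : Fin 3) {q : ℝ}
    (hq : 0 ≤ q) : volume (hull T ∩ Metric.closedBall (vertex T i) q)
      ≤ ENNReal.ofReal (q ^ 2 / 2 * angle T i) := by
  have hc : cross (vertex T (i + 1) - vertex T i) (vertex T (i + 2) - vertex T i) ≠ 0 := by
    rw [← crossAt_eq T i] at hT
    exact hT
  have hsub : hull T ∩ Metric.closedBall (vertex T i) q ⊆
      (fun x => vertex T i + x) '' (cone (vertex T (i + 1) - vertex T i)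
        (vertex T (i + 2) - vertex T i) ∩ Metric.ball 0 q) ∪ Metric.sphere (vertex T i) q := by
    rintro x ⟨hx, hxq⟩
    rw [hull_eq_convexHull T i, mem_convexHull_triple] at hx
    obtain ⟨α, β, hα, hβ, -, rfl⟩ := hx
    rw [Metric.mem_closedBall] at hxq
    rcases hxq.lt_or_eq with h | h
    · exact Or.inl ⟨_, ⟨⟨α, β, hα, hβ, rfl⟩, by simpa [dist_eq_norm] using h⟩, rfl⟩
    · exact Or.inr h
  refine (measure_mono hsub).trans ((measure_union_le _ _).trans ?_)
  rw [Measure.addHaar_sphere, add_zero, image_add_left, measure_preimage_add,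
    volume_cone_inter_ball hc hq]
  rfl

theorem measurableSet_hull (T : Triangle) : MeasurableSet (hull T) :=
  ((finite_range _).isCompact_convexHull ℝ).isClosed.measurableSet

theorem volume_hull_ne_top (T : Triangle) : volume (hull T) ≠ ⊤ :=
  ((finite_range _).isCompact_convexHull ℝ).measure_lt_top.ne

/-- Subadditivity of the measure is enough: overlaps between the discs would only lower the
left-hand side. -/
theorem cov_le_sum (T : Triangle) (hT : crossAt T 0 ≠ 0) (hq : ∀ i, 0 ≤ (T i).rad) :
    cov T ≤ ∑ i, (T i).rad ^ 2 / 2 * angle T i := by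
  have ha : ∀ i, 0 ≤ (T i).rad ^ 2 / 2 * angle T i := fun i =>
    mul_nonneg (by positivity) (EuclideanGeometry.angle_nonneg _ _ _)
  refine ENNReal.toReal_le_of_le_ofReal (Finset.sum_nonneg fun i _ => ha i) ?_
  rw [inter_iUnion, ENNReal.ofReal_sum_of_nonneg fun i _ => ha i]
  exact (measure_iUnion_fintype_le _ _).trans
    (Finset.sum_le_sum fun i _ => volume_hull_inter_closedBall_le T hT i (hq i))

/-- The circles of a tight triangle do not cross the opposite edges. -/
theorem cone_inter_ball_subset_hull (T : Triangle) (hq : ∀ i, 0 < (T i).rad)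
    (ht : ∀ i j, i ≠ j → dist (vertex T i) (vertex T j) = (T i).rad + (T j).rad) (i : Fin 3) :
    (fun x => vertex T i + x) '' (cone (vertex T (i + 1) - vertex T i)
        (vertex T (i + 2) - vertex T i) ∩ Metric.ball 0 (T i).rad)
      ⊆ hull T ∩ Metric.ball (vertex T i) (T i).rad := by
  rintro _ ⟨_, ⟨⟨α, β, hα, hβ, rfl⟩, hb⟩, rfl⟩
  have hb' : ‖α • (vertex T (i + 1) - vertex T i) + β • (vertex T (i + 2) - vertex T i)‖
      < (T i).rad := by simpa using hb
  refine ⟨?_, by simpa [dist_eq_norm] using hb⟩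
  rw [hull_eq_convexHull T i, mem_convexHull_triple]
  refine ⟨α, β, hα, hβ, ?_, rfl⟩
  by_contra! hlt
  have h01 : ‖vertex T (i + 1) - vertex T i‖ = (T (i + 1)).rad + (T i).rad := by
    rw [← dist_eq_norm, ht _ _ (by fin_cases i <;> decide)]
  have h02 : ‖vertex T (i + 2) - vertex T i‖ = (T (i + 2)).rad + (T i).rad := by
    rw [← dist_eq_norm, ht _ _ (by fin_cases i <;> decide)]
  have h12 : ‖vertex T (i + 1) - vertex T (i + 2)‖ = (T (i + 1)).rad + (T (i + 2)).rad := by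
    rw [← dist_eq_norm, ht _ _ (by fin_cases i <;> decide)]
  have hq0 := hq i
  generalize vertex T i = a at *
  generalize vertex T (i + 1) = b at *
  generalize vertex T (i + 2) = c at *
  generalize (T i).rad = q₀ at *
  generalize (T (i + 1)).rad = q₁ at *
  generalize (T (i + 2)).rad = q₂ at *
  -- A point p of the cone beyond the opposite edge has α + β > 1. These two decompositions and the
  -- triangle inequality give |p| ≥ (α + β) q₀ + (α q₁ − β q₂) and the same with the bracket
  -- negated, hence |p| ≥ (α + β) q₀ > q₀.
  have e1 : (α + β) • (b - a) = (α • (b - a) + β • (c - a)) + β • (b - c) := by module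
  have e2 : (α + β) • (c - a) = (α • (b - a) + β • (c - a)) - α • (b - c) := by module
  have n1 := norm_add_le (α • (b - a) + β • (c - a)) (β • (b - c))
  have n2 := norm_sub_le (α • (b - a) + β • (c - a)) (α • (b - c))
  rw [← e1, norm_smul, norm_smul, Real.norm_of_nonneg hβ, Real.norm_of_nonneg (by linarith), h01,
    h12] at n1
  rw [← e2, norm_smul, norm_smul, Real.norm_of_nonneg hα, Real.norm_of_nonneg (by linarith), h02,
    h12] at n2
  have hn : (α + β) * q₀ ≤ ‖α • (b - a) + β • (c - a)‖ := by
    by_cases h : β * q₂ ≤ α * q₁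
    · nlinarith
    · nlinarith
  nlinarith

/-- For the lower bound, the open sectors lie inside the triangle and the open discs are pairwise
disjoint, so the areas of the sectors add up. -/
theorem cov_eq_sum_of_tight (T : Triangle) (hT : crossAt T 0 ≠ 0) (hq : ∀ i, 0 < (T i).rad)
    (ht : ∀ i j, i ≠ j → dist (vertex T i) (vertex T j) = (T i).rad + (T j).rad) :
    cov T = ∑ i, (T i).rad ^ 2 / 2 * angle T i := by
  refine le_antisymm (cov_le_sum T hT fun i => (hq i).le) ?_
  have ha : ∀ i, 0 ≤ (T i).rad ^ 2 / 2 * angle T i := fun i =>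
    mul_nonneg (by positivity) (EuclideanGeometry.angle_nonneg _ _ _)
  have hfin : volume (hull T ∩ ⋃ i, Metric.closedBall (vertex T i) (T i).rad) ≠ ⊤ :=
    measure_ne_top_of_subset inter_subset_left (volume_hull_ne_top T)
  rw [cov, measureReal_def, ← ENNReal.ofReal_le_iff_le_toReal hfin,
    ENNReal.ofReal_sum_of_nonneg fun i _ => ha i]
  have hd : Pairwise (Function.onFun Disjoint
      fun i => hull T ∩ Metric.ball (vertex T i) (T i).rad) := by
    intro i j hij
    exact (Metric.ball_disjoint_ball (ht i j hij).ge).mono inter_subset_right inter_subset_right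
  have hU := measure_iUnion (μ := volume) hd
    fun i => (measurableSet_hull T).inter Metric.isOpen_ball.measurableSet
  rw [tsum_fintype] at hU
  calc ∑ i, ENNReal.ofReal ((T i).rad ^ 2 / 2 * angle T i)
      ≤ ∑ i, volume (hull T ∩ Metric.ball (vertex T i) (T i).rad) := by
        refine Finset.sum_le_sum fun i _ => ?_
        have hc : cross (vertex T (i + 1) - vertex T i) (vertex T (i + 2) - vertex T i) ≠ 0 := by
          rw [← crossAt_eq T i] at hT
          exact hT
        refine le_trans (le_of_eq ?_) (measure_mono (cone_inter_ball_subset_hull T hq ht i))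
        rw [image_add_left, measure_preimage_add, volume_cone_inter_ball hc (hq i).le]
        rfl
    _ = volume (⋃ i, hull T ∩ Metric.ball (vertex T i) (T i).rad) := hU.symm
    _ ≤ _ := by
        rw [← inter_iUnion]
        exact measure_mono (inter_subset_inter_right _
          (iUnion_mono fun i => Metric.ball_subset_closedBall))

/-! ### Variation of the angles and the area with the sides -/

theorem ang_comm (a b c : ℝ) : ang a b c = ang a c b := by
  unfold ang
  ring_nf

theorem ar_comm (a b c : ℝ) : ar a b c = ar a c b := by
  unfold ar
  ring_nf

theorem ar_rotate (a b c : ℝ) : ar a b c = ar b c a := by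
  unfold ar
  ring_nf

/-- Rewrites √(1 − f²) as √S / k. With S equal to 16 area², symmetric in the sides, all angle
derivatives get the same square root. -/
theorem hasDerivAt_arccos_of_sq {f : ℝ → ℝ} {f' x k S : ℝ} (hf : HasDerivAt f f' x) (hk : 0 < k)
    (hS : 0 < S) (h : (1 - f x ^ 2) * k ^ 2 = S) :
    HasDerivAt (fun y => Real.arccos (f y)) (-(f' * k / √S)) x := by
  have hpos : 0 < 1 - f x ^ 2 := by
    rw [← h] at hS
    exact pos_of_mul_pos_left hS (by positivity)
  have h1 : f x ≠ -1 := by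
    intro h1
    rw [h1] at hpos
    norm_num at hpos
  have h2 : f x ≠ 1 := by
    intro h1
    rw [h1] at hpos
    norm_num at hpos
  refine ((Real.hasDerivAt_arccos h1 h2).comp x hf).congr_deriv ?_
  have hs : √S = √(1 - f x ^ 2) * k := by
    rw [← h, Real.sqrt_mul hpos.le, Real.sqrt_sq hk.le]
  have := Real.sqrt_pos.2 hpos
  rw [hs]
  field_simp

theorem hasDerivAt_ang_opposite {a b c : ℝ} (hb : 0 < b) (hc : 0 < c)
    (hS : 0 < 4 * b ^ 2 * c ^ 2 - (b ^ 2 + c ^ 2 - a ^ 2) ^ 2) :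
    HasDerivAt (fun x => ang x b c)
      (2 * a / √(4 * b ^ 2 * c ^ 2 - (b ^ 2 + c ^ 2 - a ^ 2) ^ 2)) a := by
  have hf : HasDerivAt (fun x : ℝ => (b ^ 2 + c ^ 2 - x ^ 2) / (2 * b * c))
      (-(2 * a) / (2 * b * c)) a := by
    have := (((hasDerivAt_pow 2 a).const_sub (b ^ 2 + c ^ 2)).div_const (2 * b * c))
    exact this.congr_deriv (by norm_num)
  refine (hasDerivAt_arccos_of_sq hf (k := 2 * b * c) (by positivity) hS ?_).congr_deriv ?_
  · field_simp
    ring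
  · field_simp

theorem hasDerivAt_ang_adjacent {a b c : ℝ} (ha : 0 < a) (hc : 0 < c)
    (hS : 0 < 4 * b ^ 2 * c ^ 2 - (b ^ 2 + c ^ 2 - a ^ 2) ^ 2) :
    HasDerivAt (fun x => ang b c x)
      (-(a ^ 2 + b ^ 2 - c ^ 2) / (a * √(4 * b ^ 2 * c ^ 2 - (b ^ 2 + c ^ 2 - a ^ 2) ^ 2))) a := by
  have hf : HasDerivAt (fun x : ℝ => (c ^ 2 + x ^ 2 - b ^ 2) / (2 * c * x))
      ((a ^ 2 + b ^ 2 - c ^ 2) / (2 * c * a ^ 2)) a := by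
    have := (((hasDerivAt_pow 2 a).const_add (c ^ 2)).sub_const (b ^ 2)).div
      ((hasDerivAt_id a).const_mul (2 * c)) (mul_pos (mul_pos two_pos hc) ha).ne'
    refine this.congr_deriv ?_
    simp
    field_simp
    ring
  refine (hasDerivAt_arccos_of_sq hf (k := 2 * c * a) (by positivity) hS ?_).congr_deriv ?_
  · field_simp
    ring
  · field_simp

theorem hasDerivAt_ar {a b c : ℝ}
    (hS : 0 < 4 * b ^ 2 * c ^ 2 - (b ^ 2 + c ^ 2 - a ^ 2) ^ 2) :
    HasDerivAt (fun x => ar x b c)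
      (a * (b ^ 2 + c ^ 2 - a ^ 2) /
        (2 * √(4 * b ^ 2 * c ^ 2 - (b ^ 2 + c ^ 2 - a ^ 2) ^ 2))) a := by
  have hf : HasDerivAt (fun x : ℝ => 4 * b ^ 2 * c ^ 2 - (b ^ 2 + c ^ 2 - x ^ 2) ^ 2)
      (4 * a * (b ^ 2 + c ^ 2 - a ^ 2)) a := by
    have := ((((hasDerivAt_pow 2 a).const_sub (b ^ 2 + c ^ 2)).pow 2).const_sub
      (4 * b ^ 2 * c ^ 2))
    refine this.congr_deriv ?_
    norm_num
    ring
  refine ((hf.sqrt hS.ne').div_const 4).congr_deriv ?_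
  have := Real.sqrt_pos.2 hS
  field_simp

/-- `d` times the area minus the sum of the angles weighted by `w`, for a triangle with sides `a`,
`b`, `c`. -/
noncomputable def defect (d w₀ w₁ w₂ a b c : ℝ) : ℝ :=
  d * ar a b c - w₀ * ang a b c - w₁ * ang b c a - w₂ * ang c a b

theorem defect_rotate (d w₀ w₁ w₂ a b c : ℝ) :
    defect d w₀ w₁ w₂ a b c = defect d w₁ w₂ w₀ b c a := by
  unfold defect
  rw [ar_rotate]
  ring

theorem defect_swap (d w₀ w₁ w₂ a b c : ℝ) :
    defect d w₀ w₁ w₂ a b c = defect d w₀ w₂ w₁ a c b := by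
  unfold defect
  rw [ar_comm, ang_comm a b c, ang_comm b c a, ang_comm c a b]
  ring

/-- The hypotheses make the derivative nonnegative along the whole interval: those on `b ^ 2 + c ^ 2
- a' ^ 2` are needed at its right end, the other non-obtuseness conditions at its left end. The
condition `hbc` with `hA` keeps the triangle nondegenerate. -/
theorem defect_mono {d w₀ w₁ w₂ a a' b c : ℝ} (hd : 0 ≤ d) (hw₁ : 0 ≤ w₁) (hw₂ : 0 ≤ w₂)
    (ha : 0 < a) (hb : 0 < b) (hc : 0 < c) (haa' : a ≤ a') (hbc : (b - c) ^ 2 < a ^ 2)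
    (hA : 0 ≤ b ^ 2 + c ^ 2 - a' ^ 2) (hB : 0 ≤ a ^ 2 + c ^ 2 - b ^ 2)
    (hC : 0 ≤ a ^ 2 + b ^ 2 - c ^ 2) (hw₀ : 4 * w₀ ≤ d * (b ^ 2 + c ^ 2 - a' ^ 2)) :
    defect d w₀ w₁ w₂ a b c ≤ defect d w₀ w₁ w₂ a' b c := by
  have hsq : ∀ x ∈ Icc a a', a ^ 2 ≤ x ^ 2 ∧ x ^ 2 ≤ a' ^ 2 := fun x hx =>
    ⟨pow_le_pow_left₀ ha.le hx.1 2, pow_le_pow_left₀ (ha.le.trans hx.1) hx.2 2⟩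
  have hS : ∀ x ∈ Icc a a', 0 < 4 * b ^ 2 * c ^ 2 - (b ^ 2 + c ^ 2 - x ^ 2) ^ 2 := by
    intro x hx
    obtain ⟨h1, h2⟩ := hsq x hx
    have h3 : 0 < x ^ 2 - (b - c) ^ 2 := by linarith
    have h4 : 0 < (b + c) ^ 2 - x ^ 2 := by nlinarith [mul_pos hb hc]
    nlinarith [mul_pos h3 h4]
  have hder : ∀ x ∈ Icc a a', ∃ D, 0 ≤ D ∧
      HasDerivAt (fun x => defect d w₀ w₁ w₂ x b c) D x := by
    intro x hx
    obtain ⟨h1, h2⟩ := hsq x hx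
    have hx0 : 0 < x := ha.trans_le hx.1
    have hS1 := hS x hx
    have hS2 : 4 * c ^ 2 * b ^ 2 - (c ^ 2 + b ^ 2 - x ^ 2) ^ 2
      = 4 * b ^ 2 * c ^ 2 - (b ^ 2 + c ^ 2 - x ^ 2) ^ 2 := by ring
    have h3 : HasDerivAt (fun x => ang c x b) (-(x ^ 2 + c ^ 2 - b ^ 2) /
        (x * √(4 * c ^ 2 * b ^ 2 - (c ^ 2 + b ^ 2 - x ^ 2) ^ 2))) x := by
      simp_rw [fun x => ang_comm c x b]
      exact hasDerivAt_ang_adjacent hx0 hb (hS2.symm ▸ hS1)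
    refine ⟨_, ?_, ((((hasDerivAt_ar hS1).const_mul d).sub
      ((hasDerivAt_ang_opposite hb hc hS1).const_mul w₀)).sub
      ((hasDerivAt_ang_adjacent hx0 hc hS1).const_mul w₁)).sub (h3.const_mul w₂)⟩
    rw [hS2]
    have hS3 := Real.sqrt_pos.2 hS1
    set S := √(4 * b ^ 2 * c ^ 2 - (b ^ 2 + c ^ 2 - x ^ 2) ^ 2)
    -- Separates the competition between the area and the opposite angle from the favourable
    -- contribution of the adjacent angles.
    have e : d * (x * (b ^ 2 + c ^ 2 - x ^ 2) / (2 * S)) - w₀ * (2 * x / S)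
        - w₁ * (-(x ^ 2 + b ^ 2 - c ^ 2) / (x * S)) - w₂ * (-(x ^ 2 + c ^ 2 - b ^ 2) / (x * S))
        = (x * (d * (b ^ 2 + c ^ 2 - x ^ 2) - 4 * w₀)) / (2 * S)
          + (w₁ * (x ^ 2 + b ^ 2 - c ^ 2) + w₂ * (x ^ 2 + c ^ 2 - b ^ 2)) / (x * S) := by
      field_simp
      ring
    rw [e]
    have k1 : 0 ≤ d * (b ^ 2 + c ^ 2 - x ^ 2) - 4 * w₀ := by nlinarith
    have k2 : 0 ≤ x ^ 2 + b ^ 2 - c ^ 2 := by linarith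
    have k3 : 0 ≤ x ^ 2 + c ^ 2 - b ^ 2 := by linarith
    positivity
  have hmono : MonotoneOn (fun x => defect d w₀ w₁ w₂ x b c) (Icc a a') := by
    apply monotoneOn_of_deriv_nonneg (convex_Icc _ _)
    · intro x hx
      obtain ⟨D, -, h⟩ := hder x hx
      exact h.continuousAt.continuousWithinAt
    · intro x hx
      obtain ⟨D, -, h⟩ := hder x (interior_subset hx)
      exact h.differentiableAt.differentiableWithinAt
    · intro x hx
      obtain ⟨D, hD, h⟩ := hder x (interior_subset hx)
      rw [h.deriv]
      exact hD
  exact hmono ⟨le_rfl, haa'⟩ ⟨haa', le_rfl⟩ haa'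

/-- Enlarging the three sides of the tight triangle with circles of radii `x`, `y`, `z`. -/
theorem defect_tight_le {d w₀ w₁ w₂ x y z a b c e : ℝ} (hd : 0 ≤ d) (hw₀ : 0 ≤ w₀) (hw₁ : 0 ≤ w₁)
    (hw₂ : 0 ≤ w₂) (hx : x ∈ Icc 0.65 1) (hy : y ∈ Icc 0.65 1) (hz : z ∈ Icc 0.65 1)
    (he : e ≤ 0.0562)
    (ha : a ∈ Icc (y + z) (y + z + e)) (hb : b ∈ Icc (z + x) (z + x + e))
    (hc : c ∈ Icc (x + y) (x + y + e))
    (h₀ : 4 * w₀ ≤ d * ((z + x) ^ 2 + (x + y) ^ 2 - (y + z + e) ^ 2))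
    (h₁ : 4 * w₁ ≤ d * ((x + y) ^ 2 + (y + z) ^ 2 - (z + x + e) ^ 2))
    (h₂ : 4 * w₂ ≤ d * ((y + z) ^ 2 + (z + x) ^ 2 - (x + y + e) ^ 2)) :
    defect d w₀ w₁ w₂ (y + z) (z + x) (x + y) ≤ defect d w₀ w₁ w₂ a b c := by
  -- One side grows while the other two are anywhere in their intervals, so that the same statement,
  -- with rotated labels, serves for each side in turn.
  have step : ∀ {w₀ w₁ w₂ x y z a b c : ℝ}, 0 ≤ w₀ → 0 ≤ w₁ → 0 ≤ w₂ → x ∈ Icc (0.65 : ℝ) 1 →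
      y ∈ Icc (0.65 : ℝ) 1 → z ∈ Icc (0.65 : ℝ) 1 → a ∈ Icc (y + z) (y + z + e) →
      b ∈ Icc (z + x) (z + x + e) → c ∈ Icc (x + y) (x + y + e) →
      4 * w₀ ≤ d * ((z + x) ^ 2 + (x + y) ^ 2 - (y + z + e) ^ 2) →
      defect d w₀ w₁ w₂ (y + z) b c ≤ defect d w₀ w₁ w₂ a b c := by
    rintro w₀ w₁ w₂ x y z a b c hw₀ hw₁ hw₂ ⟨hx, hx'⟩ ⟨hy, hy'⟩ ⟨hz, hz'⟩ ⟨ha, ha'⟩ ⟨hb, hb'⟩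
      ⟨hc, hc'⟩ h
    -- The worst case takes the opposite side longest, the others shortest and x = 0.65, which
    -- leaves a quadratic inequality for y, z in [0.65, 1].
    have acute : ∀ {x y z a b c : ℝ}, 0.65 ≤ x → 0.65 ≤ y → 0.65 ≤ z → y ≤ 1 → z ≤ 1 → 0 ≤ a →
        a ≤ y + z + e → z + x ≤ b → x + y ≤ c → 0 ≤ b ^ 2 + c ^ 2 - a ^ 2 := by
      intro x y z a b c hx hy hz hy' hz' ha0 ha hb hc
      have k1 : a ^ 2 ≤ (y + z + 0.0562) ^ 2 := pow_le_pow_left₀ ha0 (by linarith) 2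
      have k2 : (z + 0.65) ^ 2 ≤ b ^ 2 := pow_le_pow_left₀ (by linarith) (by linarith) 2
      have k3 : (y + 0.65) ^ 2 ≤ c ^ 2 := pow_le_pow_left₀ (by linarith) (by linarith) 2
      nlinarith [mul_nonneg (sub_nonneg.2 hy') (sub_nonneg.2 hz'),
        mul_nonneg (sub_nonneg.2 hy) (sub_nonneg.2 hz')]
    have e0 : 0 ≤ e := by linarith
    have hb0 : 0 ≤ b := by linarith
    have hc0 : 0 ≤ c := by linarith
    have ha0 : 0 ≤ a := by linarith
    refine defect_mono hd hw₁ hw₂ (by linarith) (by linarith) (by linarith) ha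
      (sq_lt_sq' (by linarith) (by linarith)) (acute hx hy hz hy' hz' ha0 ha' hb hc)
      ?_ ?_ (h.trans (mul_le_mul_of_nonneg_left ?_ hd))
    · rw [add_comm (_ ^ 2)]
      exact acute hy hz hx hz' hx' hb0 hb' hc le_rfl
    · exact acute hz hx hy hx' hy' hc0 hc' le_rfl hb
    · have k1 : a ^ 2 ≤ (y + z + e) ^ 2 := pow_le_pow_left₀ ha0 (by linarith) 2
      have k2 : (z + x) ^ 2 ≤ b ^ 2 := pow_le_pow_left₀ (by linarith) (by linarith) 2
      have k3 : (x + y) ^ 2 ≤ c ^ 2 := pow_le_pow_left₀ (by linarith) (by linarith) 2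
      linarith
  have e0 : 0 ≤ e := by linarith [ha.1, ha.2]
  have hlo : ∀ t : ℝ, t ∈ Icc t (t + e) := fun t => ⟨le_rfl, by linarith⟩
  calc defect d w₀ w₁ w₂ (y + z) (z + x) (x + y)
      ≤ defect d w₀ w₁ w₂ a (z + x) (x + y) :=
        step hw₀ hw₁ hw₂ hx hy hz ha (hlo _) (hlo _) h₀
    _ ≤ defect d w₀ w₁ w₂ a b (x + y) := by
        rw [defect_rotate, defect_rotate d w₀ w₁ w₂ a b]
        exact step hw₁ hw₂ hw₀ hy hz hx hb (hlo _) ha h₁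
    _ ≤ defect d w₀ w₁ w₂ a b c := by
        rw [← defect_rotate, ← defect_rotate d w₂ w₀ w₁ c a b]
        exact step hw₂ hw₀ hw₁ hz hx hy hc ha hb h₂

/-! ### Tight triangles and their excess -/

theorem r_mem : r ∈ Ioo (0.8335 : ℝ) 0.8345 := (Classical.choose_spec existsUnique_r.exists).1

theorem s_mem : s ∈ Ioo (0.6505 : ℝ) 0.6515 := (Classical.choose_spec existsUnique_s.exists).1

theorem rad_mem (a : Size) : a.rad ∈ Icc (0.65 : ℝ) 1 := by
  obtain ⟨h1, h2⟩ := r_mem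
  obtain ⟨h3, h4⟩ := s_mem
  cases a <;> simp only [rad] <;> constructor <;> linarith

theorem rad_pos (a : Size) : 0 < a.rad := lt_of_lt_of_le (by norm_num) (rad_mem a).1

/-- The height of the third vertex of a tight triangle. -/
theorem tight_height_sq {a b c : ℝ} (ha : 0 < a) (hb : 0 < b) :
    (a + c) ^ 2 - (((a + b) ^ 2 + (a + c) ^ 2 - (b + c) ^ 2) / (2 * (a + b))) ^ 2
      = 4 * a * b * c * (a + b + c) / (a + b) ^ 2 := by
  field_simp
  ring

theorem tightTriangle_spec (a b c : Size) :
    crossAt (tightTriangle a b c) 0 ≠ 0 ∧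
      edge (tightTriangle a b c) 0 = b.rad + c.rad ∧
      edge (tightTriangle a b c) 1 = c.rad + a.rad ∧
      edge (tightTriangle a b c) 2 = a.rad + b.rad := by
  have ha := rad_pos a
  have hb := rad_pos b
  have hc := rad_pos c
  set A := a.rad
  set B := b.rad
  set C := c.rad
  set x := ((A + B) ^ 2 + (A + C) ^ 2 - (B + C) ^ 2) / (2 * (A + B)) with hx
  have hh : 0 < (A + C) ^ 2 - x ^ 2 := by
    rw [hx, tight_height_sq ha hb]
    positivity
  have hx' : 2 * x * (A + B) = (A + B) ^ 2 + (A + C) ^ 2 - (B + C) ^ 2 := by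
    rw [hx]
    field_simp
  have v0 : vertex (tightTriangle a b c) 0 = !₂[0, 0] := rfl
  have v1 : vertex (tightTriangle a b c) 1 = !₂[A + B, 0] := rfl
  have v2 : vertex (tightTriangle a b c) 2 = !₂[x, √((A + C) ^ 2 - x ^ 2)] := rfl
  have hs := Real.sq_sqrt hh.le
  refine ⟨?_, ?_, ?_, ?_⟩
  · rw [crossAt, zero_add, zero_add, v0, v1, v2, cross]
    have := Real.sqrt_pos.2 hh
    simp
    exact ⟨by positivity, by positivity⟩
  · rw [edge, zero_add, zero_add, v1, v2, EuclideanSpace.dist_eq, Real.sqrt_eq_iff_mul_self_eq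
      (by positivity) (by positivity)]
    simp [Real.dist_eq, sq_abs]
    linarith
  · rw [edge, show (1 : Fin 3) + 1 = 2 from rfl, show (1 : Fin 3) + 2 = 0 from rfl, v2, v0,
      EuclideanSpace.dist_eq, Real.sqrt_eq_iff_mul_self_eq (by positivity) (by positivity)]
    simp [Real.dist_eq, sq_abs]
    linarith
  · rw [edge, show (2 : Fin 3) + 1 = 0 from rfl, show (2 : Fin 3) + 2 = 1 from rfl, v0, v1,
      EuclideanSpace.dist_eq, Real.sqrt_eq_iff_mul_self_eq (by positivity) (by positivity)]
    simp [Real.dist_eq, sq_abs]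
    linarith

/-- The three indices sum to 0 modulo 3, so −(i + j) is the index of the vertex opposite to the
edge. -/
theorem dist_vertex (T : Triangle) {i j : Fin 3} (hij : i ≠ j) :
    dist (vertex T i) (vertex T j) = edge T (-(i + j)) := by
  fin_cases i <;> fin_cases j <;> first | exact absurd rfl hij | rfl | exact dist_comm _ _

theorem cov_tightTriangle (a b c : Size) :
    cov (tightTriangle a b c)
      = a.rad ^ 2 / 2 * ang (b.rad + c.rad) (c.rad + a.rad) (a.rad + b.rad)
        + b.rad ^ 2 / 2 * ang (c.rad + a.rad) (a.rad + b.rad) (b.rad + c.rad)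
        + c.rad ^ 2 / 2 * ang (a.rad + b.rad) (b.rad + c.rad) (c.rad + a.rad) := by
  obtain ⟨h, h0, h1, h2⟩ := tightTriangle_spec a b c
  have e0 : (tightTriangle a b c 0).rad = a.rad := rfl
  have e1 : (tightTriangle a b c 1).rad = b.rad := rfl
  have e2 : (tightTriangle a b c 2).rad = c.rad := rfl
  rw [cov_eq_sum_of_tight _ h (fun i => rad_pos _), Fin.sum_univ_three, e0, e1, e2]
  · simp only [angle_eq_ang, zero_add, show (1 : Fin 3) + 1 = 2 from rfl,
      show (1 : Fin 3) + 2 = 0 from rfl, show (2 : Fin 3) + 1 = 0 from rfl,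
      show (2 : Fin 3) + 2 = 1 from rfl, h0, h1, h2]
  · intro i j hij
    rw [dist_vertex _ hij]
    fin_cases i <;> fin_cases j <;> first
      | exact absurd rfl hij
      | exact h0.trans (by rw [← e1, ← e2]; rfl)
      | exact h0.trans (by rw [← e1, ← e2, add_comm]; rfl)
      | exact h1.trans (by rw [← e0, ← e2]; rfl)
      | exact h1.trans (by rw [← e0, ← e2, add_comm]; rfl)
      | exact h2.trans (by rw [← e0, ← e1]; rfl)
      | exact h2.trans (by rw [← e0, ← e1, add_comm]; rfl)

theorem area_tightTriangle (a b c : Size) :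
    area (tightTriangle a b c) = ar (b.rad + c.rad) (c.rad + a.rad) (a.rad + b.rad) := by
  obtain ⟨-, h0, h1, h2⟩ := tightTriangle_spec a b c
  rw [area_eq_ar, h0, h1, h2]

theorem excess_tightTriangle (a b c : Size) :
    excess (tightTriangle a b c) = defect density (a.rad ^ 2 / 2) (b.rad ^ 2 / 2) (c.rad ^ 2 / 2)
      (b.rad + c.rad) (c.rad + a.rad) (a.rad + b.rad) := by
  rw [excess, defect, cov_tightTriangle, area_tightTriangle]
  ring

theorem excess_tightTriangle_rotate (a b c : Size) :
    excess (tightTriangle a b c) = excess (tightTriangle b c a) := by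
  rw [excess_tightTriangle, excess_tightTriangle, defect_rotate]

theorem excess_tightTriangle_swap (a b c : Size) :
    excess (tightTriangle a b c) = excess (tightTriangle a c b) := by
  rw [excess_tightTriangle, excess_tightTriangle, defect_swap, add_comm b.rad c.rad,
    add_comm c.rad a.rad, add_comm a.rad b.rad]

theorem tightPotential_spec : IsTightPotential tightPotential :=
  Classical.choose_spec existsUnique_tightPotential.exists

/-- The defining equations cover only triples sorted by rank; rotations and swaps extend them to
every order, as the excess is invariant under both. -/
theorem tightPotential_sum (a b c : Size) :
    tightPotential b a c + tightPotential c b a + tightPotential a c b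
      = excess (tightTriangle a b c) := by
  have t := tightPotential_spec.tight
  have y := tightPotential_spec.symm
  have rot : ∀ {a b c : Size}, tightPotential c a b + tightPotential a b c + tightPotential b c a
      = excess (tightTriangle a b c) →
      tightPotential a b c + tightPotential b c a + tightPotential c a b
      = excess (tightTriangle b c a) := by
    intro a b c h
    rw [← excess_tightTriangle_rotate]
    linarith
  have swap : ∀ {a b c : Size}, tightPotential c a b + tightPotential a b c + tightPotential b c a
      = excess (tightTriangle a b c) →
      tightPotential b a c + tightPotential a c b + tightPotential c b a
      = excess (tightTriangle a c b) := by
    intro a b c h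
    rw [← excess_tightTriangle_swap]
    linarith [y a b c, y b c a, y c a b]
  have main : ∀ a b c : Size, tightPotential c a b + tightPotential a b c + tightPotential b c a
      = excess (tightTriangle a b c) := by
    intro a b c
    have tot := fun u v : Size => le_total u.rank v.rank
    rcases tot a b with h1 | h1 <;> rcases tot b c with h2 | h2 <;> rcases tot a c with h3 | h3
    · exact t _ _ _ h1 h2
    · exact t _ _ _ h1 h2
    · exact swap (t _ _ _ h3 h2)
    · exact rot (t _ _ _ h3 h1)
    · exact rot (rot (swap (t _ _ _ h1 h3)))
    · exact rot (rot (t _ _ _ h2 h3))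
    · exact rot (swap (t _ _ _ h2 h1))
    · exact rot (swap (t _ _ _ h2 h1))
  rw [← main, y c a b, y a b c, y b c a]

/-! ### Lower bound on the density -/

/-- An angle θ is at least its chord: θ² ≥ 2 (1 − cos θ), which equals 4yz / ((x + y)(x + z)) here.
-/
theorem le_ang_tight {x y z k : ℝ} (hx : 0 < x) (hy : 0 < y) (hz : 0 < z)
    (hk : k ^ 2 * ((x + y) * (x + z)) ≤ 4 * (y * z)) : k ≤ ang (y + z) (z + x) (x + y) := by
  have h1 : ((z + x) ^ 2 + (x + y) ^ 2 - (y + z) ^ 2) / (2 * (z + x) * (x + y))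
      = 1 - 2 * (y * z) / ((x + y) * (x + z)) := by
    field_simp
    ring
  have hle : 2 * (y * z) / ((x + y) * (x + z)) ≤ 2 := by
    rw [div_le_iff₀ (by positivity)]
    nlinarith [mul_pos hx hy, mul_pos hx hz, mul_pos hx hx]
  have hnn : 0 ≤ 2 * (y * z) / ((x + y) * (x + z)) := by positivity
  have hk' : k ^ 2 ≤ 2 * (2 * (y * z) / ((x + y) * (x + z))) := by
    rw [← mul_div_assoc, le_div_iff₀ (by positivity)]
    linarith
  rw [ang, h1]
  have h2 := Real.one_sub_sq_div_two_le_cos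
    (x := Real.arccos (1 - 2 * (y * z) / ((x + y) * (x + z))))
  rw [Real.cos_arccos (by linarith) (by linarith)] at h2
  exact (le_abs_self k).trans (abs_le_of_sq_le_sq (by linarith) (Real.arccos_nonneg _))

/-- Heron's formula: the semiperimeter is x + y + z, so the squared area is xyz (x + y + z). -/
theorem ar_tight_le {x y z N : ℝ} (hN : 0 ≤ N) (h : x * y * z * (x + y + z) ≤ N ^ 2) :
    ar (y + z) (z + x) (x + y) ≤ N := by
  rw [ar, div_le_iff₀ (by norm_num), Real.sqrt_le_left (by positivity)]
  nlinarith

theorem area_tightTriangle_le_cov {a b c : Size} {k₀ k₁ k₂ N : ℝ} (hN : 0 ≤ N)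
    (h₀ : k₀ ^ 2 * ((a.rad + b.rad) * (a.rad + c.rad)) ≤ 4 * (b.rad * c.rad))
    (h₁ : k₁ ^ 2 * ((b.rad + c.rad) * (b.rad + a.rad)) ≤ 4 * (c.rad * a.rad))
    (h₂ : k₂ ^ 2 * ((c.rad + a.rad) * (c.rad + b.rad)) ≤ 4 * (a.rad * b.rad))
    (h : a.rad * b.rad * c.rad * (a.rad + b.rad + c.rad) ≤ N ^ 2)
    (hk : 0.85 * N ≤ a.rad ^ 2 / 2 * k₀ + b.rad ^ 2 / 2 * k₁ + c.rad ^ 2 / 2 * k₂) :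
    0.85 * area (tightTriangle a b c) ≤ cov (tightTriangle a b c) := by
  have ha := rad_pos a
  have hb := rad_pos b
  have hc := rad_pos c
  rw [area_tightTriangle, cov_tightTriangle]
  have i0 := mul_le_mul_of_nonneg_left (le_ang_tight ha hb hc h₀)
    (show 0 ≤ a.rad ^ 2 / 2 by positivity)
  have i1 := mul_le_mul_of_nonneg_left (le_ang_tight hb hc ha h₁)
    (show 0 ≤ b.rad ^ 2 / 2 by positivity)
  have i2 := mul_le_mul_of_nonneg_left (le_ang_tight hc ha hb h₂)
    (show 0 ≤ c.rad ^ 2 / 2 by positivity)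
  have := ar_tight_le hN h
  linarith

theorem area_tightTriangle_pos (a b c : Size) : 0 < area (tightTriangle a b c) := by
  have h := (tightTriangle_spec a b c).1
  rw [area, hull_eq_convexHull _ 0, volume_convexHull_triple]
  exact half_pos (abs_pos.2 h)

/-- The density is a weighted mean over three tight triangles, so it is enough that each of them is
covered in proportion at least 0.85. -/
theorem le_density : 0.85 ≤ density := by
  obtain ⟨hr1, hr2⟩ := r_mem
  obtain ⟨hs1, hs2⟩ := s_mem
  have r2 : 0.8335 ^ 2 ≤ r ^ 2 := pow_le_pow_left₀ (by norm_num) hr1.le 2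
  have s2 : 0.6505 ^ 2 ≤ s ^ 2 := pow_le_pow_left₀ (by norm_num) hs1.le 2
  have r2' : r ^ 2 ≤ 0.8345 ^ 2 := pow_le_pow_left₀ (by linarith) hr2.le 2
  have s2' : s ^ 2 ≤ 0.6515 ^ 2 := pow_le_pow_left₀ (by linarith) hs2.le 2
  have rs : 0.8335 * 0.6505 ≤ r * s :=
    mul_le_mul hr1.le hs1.le (by norm_num) (by linarith)
  have rs' : r * s ≤ 0.8345 * 0.6515 :=
    mul_le_mul hr2.le hs2.le (by linarith) (by norm_num)
  have t1 : 0.85 * area (tightTriangle large medium small)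
      ≤ cov (tightTriangle large medium small) := by
    -- Here, as for the next two triangles, the `k` are rational lower bounds for the chords of the
    -- three angles, and `N` is an upper bound for the area.
    apply area_tightTriangle_le_cov (k₀ := 0.84) (k₁ := 0.97) (k₂ := 1.158) (N := 1.165)
    · norm_num
    all_goals simp only [rad]
    · nlinarith
    · nlinarith
    · nlinarith
    · have : r * s * (1 + r + s) ≤ (0.8345 * 0.6515) * (1 + 0.8345 + 0.6515) :=
        mul_le_mul rs' (by linarith) (by linarith) (by norm_num)
      linarith
    · linarith
  have t2 : 0.85 * area (tightTriangle large large small)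
      ≤ cov (tightTriangle large large small) := by
    apply area_tightTriangle_le_cov (k₀ := 0.882) (k₁ := 0.882) (k₂ := 1.202) (N := 1.315)
    · norm_num
    all_goals simp only [rad]
    all_goals nlinarith
  have t3 : 0.85 * area (tightTriangle large medium medium)
      ≤ cov (tightTriangle large medium medium) := by
    apply area_tightTriangle_le_cov (k₀ := 0.904) (k₁ := 1.037) (k₂ := 1.037) (N := 1.364)
    · norm_num
    all_goals simp only [rad]
    · nlinarith
    · nlinarith
    · nlinarith
    · have : r ^ 2 * (1 + r + r) ≤ 0.8345 ^ 2 * (1 + 0.8345 + 0.8345) :=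
        mul_le_mul r2' (by linarith) (by linarith) (by norm_num)
      linarith
    · linarith
  have p1 := area_tightTriangle_pos large medium small
  have p2 := area_tightTriangle_pos large large small
  have p3 := area_tightTriangle_pos large medium medium
  rw [density, le_div_iff₀ (by positivity)]
  linarith

/-- The condition under which the excess grows faster than the weighted angles, for any sizes. -/
theorem weight_le {m : Size → ℝ} (hm1 : m large = 0.12) (hmr : m medium = 0.03)
    (hms : m small = 0.03) (a b c : Size) :
    4 * (a.rad ^ 2 / 2 + m a) ≤
      0.85 * ((c.rad + a.rad) ^ 2 + (a.rad + b.rad) ^ 2 - (b.rad + c.rad + 0.0562) ^ 2) := by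
  obtain ⟨hr1, hr2⟩ := r_mem
  obtain ⟨hs1, hs2⟩ := s_mem
  have r2 : 0.8335 ^ 2 ≤ r ^ 2 := pow_le_pow_left₀ (by norm_num) hr1.le 2
  have s2 : 0.6505 ^ 2 ≤ s ^ 2 := pow_le_pow_left₀ (by norm_num) hs1.le 2
  have r2' : r ^ 2 ≤ 0.8345 ^ 2 := pow_le_pow_left₀ (by linarith) hr2.le 2
  have s2' : s ^ 2 ≤ 0.6515 ^ 2 := pow_le_pow_left₀ (by linarith) hs2.le 2
  have rs : 0.8335 * 0.6505 ≤ r * s :=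
    mul_le_mul hr1.le hs1.le (by norm_num) (by linarith)
  have rs' : r * s ≤ 0.8345 * 0.6515 :=
    mul_le_mul hr2.le hs2.le (by linarith) (by norm_num)
  -- The tightest case is a small circle between two large ones, about 0.97 against 1.04.
  cases a <;> cases b <;> cases c <;> simp only [rad, hm1, hmr, hms] <;> linarith

/-! ### Comparison with the tight triangle -/

/-- A vanishing determinant gives the relations w₁ u − u₁ w = 0 and w₀ u − u₀ w = 0; independence
then forces u = 0, a contradiction. -/
theorem crossAt_ne_zero {T : Triangle} (h : AffineIndependent ℝ (vertex T)) : crossAt T 0 ≠ 0 := by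
  intro h0
  have hl := (affineIndependent_iff_linearIndependent_vsub ℝ _ (0 : Fin 3)).1 h
  set u := vertex T 1 - vertex T 0
  set w := vertex T 2 - vertex T 0
  have hp : LinearIndependent ℝ ![u, w] := by
    have := hl.comp (fun i : Fin 2 => (⟨i.succ, Fin.succ_ne_zero i⟩ : {x : Fin 3 // x ≠ 0}))
      (fun i j hij => by simpa using hij)
    have e : (fun i : {x : Fin 3 // x ≠ 0} => (vertex T i -ᵥ vertex T 0 : Plane)) ∘
        (fun i : Fin 2 => ⟨i.succ, Fin.succ_ne_zero i⟩) = ![u, w] := by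
      funext i
      fin_cases i <;> rfl
    rw [e] at this
    exact this
  have hc : u 0 * w 1 - u 1 * w 0 = 0 := h0
  rw [LinearIndependent.pair_iff] at hp
  have k1 := hp (w 1) (-(u 1)) (by
    ext i
    fin_cases i
    · simp
      linarith
    · simp
      ring)
  have k2 := hp (w 0) (-(u 0)) (by
    ext i
    fin_cases i
    · simp
      ring
    · simp
      linarith)
  have k3 := hp 1 0 (by
    ext i
    fin_cases i
    · simpa using k2.2
    · simpa using k1.2)
  exact one_ne_zero k3.1

/-- Freezing the sign makes the angular penalty linear in the angles, so that it can join the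
weights of `defect`. -/
theorem exists_sign_abs (x : ℝ) : ∃ σ : ℝ, |σ| ≤ 1 ∧ |x| = σ * x := by
  rcases abs_cases x with ⟨h, -⟩ | ⟨h, -⟩
  · exact ⟨1, by simp, by rw [h, one_mul]⟩
  · exact ⟨-1, by simp, by rw [h, neg_one_mul]⟩

theorem edge_mem {P : Set Disc} (hP : IsPacking P) {T : Triangle} (hTP : ∀ i, T i ∈ P)
    (hT : AffineIndependent ℝ (vertex T)) {ε : ℝ} (hε : IsEpsTight ε T) (i : Fin 3) :
    edge T i ∈ Icc ((T (i + 1)).rad + (T (i + 2)).rad)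
      ((T (i + 1)).rad + (T (i + 2)).rad + ε) := by
  have hij : i + 1 ≠ i + 2 := by fin_cases i <;> decide
  have hne : T (i + 1) ≠ T (i + 2) := fun h => hij (hT.injective (congrArg Disc.center h))
  have h1 := (disjoint_ball_ball_iff (rad_pos (T (i + 1)).size) (rad_pos (T (i + 2)).size)).1
    (hP (hTP (i + 1)) (hTP (i + 2)) hne)
  exact ⟨h1, by linarith [hε _ _ hij, show edge T i = dist _ _ from rfl]⟩

theorem defect_le_excess {T : Triangle} (hT : crossAt T 0 ≠ 0) :
    defect density ((T 0).rad ^ 2 / 2) ((T 1).rad ^ 2 / 2) ((T 2).rad ^ 2 / 2)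
      (edge T 0) (edge T 1) (edge T 2) ≤ excess T := by
  have h := cov_le_sum T hT fun i => (rad_pos _).le
  simp only [Fin.sum_univ_three, angle_eq_ang, zero_add, show (1 : Fin 3) + 1 = 2 from rfl,
      show (1 : Fin 3) + 2 = 0 from rfl, show (2 : Fin 3) + 1 = 0 from rfl,
      show (2 : Fin 3) + 2 = 1 from rfl] at h
  rw [excess, defect, area_eq_ar]
  linarith

/-- The excess of a triangle with nearly tight sides exceeds that of the tight triangle by at least
the weighted deviations of the angles. -/
theorem excess_tightTriangle_add_le {m : Size → ℝ} (hm1 : m large = 0.12) (hmr : m medium = 0.03)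
    (hms : m small = 0.03) {ε : ℝ} (hε : ε ≤ 0.0562) {T : Triangle} (hT : crossAt T 0 ≠ 0)
    (he : ∀ i, edge T i ∈ Icc ((T (i + 1)).rad + (T (i + 2)).rad)
      ((T (i + 1)).rad + (T (i + 2)).rad + ε)) :
    excess (tightTriangle (T 0).size (T 1).size (T 2).size)
      + ∑ i, m (T i).size
        * |angle T i - angle (tightTriangle (T 0).size (T 1).size (T 2).size) i| ≤ excess T := by
  refine le_trans ?_ (defect_le_excess hT)
  obtain ⟨-, t0, t1, t2⟩ := tightTriangle_spec (T 0).size (T 1).size (T 2).size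
  have he0 := he 0
  have he1 := he 1
  have he2 := he 2
  simp only [Fin.sum_univ_three, angle_eq_ang, zero_add, show (1 : Fin 3) + 1 = 2 from rfl,
      show (1 : Fin 3) + 2 = 0 from rfl, show (2 : Fin 3) + 1 = 0 from rfl,
      show (2 : Fin 3) + 2 = 1 from rfl, t0, t1, t2, Disc.rad] at he0 he1 he2 ⊢
  generalize (T 0).size = a at *
  generalize (T 1).size = b at *
  generalize (T 2).size = c at *
  generalize edge T 0 = x at *
  generalize edge T 1 = y at *
  generalize edge T 2 = z at *
  obtain ⟨σ₀, hσ₀, e₀⟩ := exists_sign_abs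
    (ang x y z - ang (b.rad + c.rad) (c.rad + a.rad) (a.rad + b.rad))
  obtain ⟨σ₁, hσ₁, e₁⟩ := exists_sign_abs
    (ang y z x - ang (c.rad + a.rad) (a.rad + b.rad) (b.rad + c.rad))
  obtain ⟨σ₂, hσ₂, e₂⟩ := exists_sign_abs
    (ang z x y - ang (a.rad + b.rad) (b.rad + c.rad) (c.rad + a.rad))
  -- Since m ≤ rad²/2, the weights rad²/2 + m σ stay nonnegative for either sign; the largest,
  -- rad²/2 + m, is the one tested numerically.
  have hmpos : ∀ q : Size, 0 ≤ m q ∧ m q ≤ q.rad ^ 2 / 2 := by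
    obtain ⟨hr1, hr2⟩ := r_mem
    obtain ⟨hs1, hs2⟩ := s_mem
    intro q
    cases q <;> simp only [rad, hm1, hmr, hms] <;> constructor <;> nlinarith
  have hw : ∀ (q : Size) {σ : ℝ}, |σ| ≤ 1 →
      0 ≤ q.rad ^ 2 / 2 + m q * σ ∧ q.rad ^ 2 / 2 + m q * σ ≤ q.rad ^ 2 / 2 + m q := by
    intro q σ hσ
    obtain ⟨h1, h2⟩ := abs_le.1 hσ
    obtain ⟨h3, h4⟩ := hmpos q
    constructor <;> nlinarith
  have hε0 : 0 ≤ ε := by linarith [he0.1, he0.2]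
  have hcond : ∀ (a b c : Size) {σ : ℝ}, |σ| ≤ 1 → 4 * (a.rad ^ 2 / 2 + m a * σ) ≤
      density * ((c.rad + a.rad) ^ 2 + (a.rad + b.rad) ^ 2 - (b.rad + c.rad + ε) ^ 2) := by
    intro a b c σ hσ
    have h1 := weight_le hm1 hmr hms a b c
    have h2 := hw a hσ
    have h3 : (b.rad + c.rad + ε) ^ 2 ≤ (b.rad + c.rad + 0.0562) ^ 2 :=
      pow_le_pow_left₀ (by linarith [rad_pos b, rad_pos c]) (by linarith) 2
    have h4 : 0 ≤ (c.rad + a.rad) ^ 2 + (a.rad + b.rad) ^ 2 - (b.rad + c.rad + ε) ^ 2 := by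
      linarith
    have h5 := mul_le_mul_of_nonneg_right le_density h4
    linarith
  have key := defect_tight_le (le_trans (by norm_num) le_density) (hw a hσ₀).1 (hw b hσ₁).1
    (hw c hσ₂).1 (rad_mem a) (rad_mem b) (rad_mem c) hε he0 he1 he2 (hcond a b c hσ₀)
    (hcond b c a hσ₁) (hcond c a b hσ₂)
  -- Expanding the shifted weights in `key` separates the deviations m σ (angle − tight angle), that
  -- is, the penalties.
  rw [excess_tightTriangle, e₀, e₁, e₂]
  unfold defect at key ⊢
  linarith

theorem edgePotential_eq_zero {l q : Size → Size → ℝ} {T : Triangle} {X : Plane} {i : Fin 3}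
    (h : edge T i < l (T (i + 1)).size (T (i + 2)).size) : edgePotential l q T X i = 0 :=
  if_pos h

end FM

theorem mainTheorem4
    (m : FM.Size → ℝ) (hm1 : m FM.Size.large = 0.12) (hmr : m FM.Size.medium = 0.03)
    (hms : m FM.Size.small = 0.03)
    (ε : ℝ) (hε : ε ≤ 0.0561906177650666)
    (l q : FM.Size → FM.Size → ℝ) (hl : ∀ a b : FM.Size, a.rad + b.rad + ε < l a b)
    (P : Set FM.Disc) (hP : FM.IsPacking P) (hsat : FM.IsSaturated P)
    (𝒯 : Set FM.Triangle) (h𝒯 : FM.IsFMTriangulation P 𝒯)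
    (T : FM.Triangle) (hT : T ∈ 𝒯) (hT_tight : FM.IsEpsTight ε T)
    (X : FM.Plane) (hX : FM.IsSupportCenter P T X) :
    FM.potential m l q T X ≤ FM.excess T := by
  have he := FM.edge_mem hP (h𝒯.mem T hT) (h𝒯.nondegenerate T hT) hT_tight
  have hedge : ∀ i, FM.edgePotential l q T X i = 0 := fun i =>
    FM.edgePotential_eq_zero ((he i).2.trans_lt (hl _ _))
  have hV := FM.tightPotential_sum (T 0).size (T 1).size (T 2).size
  refine le_trans (le_of_eq ?_) (FM.excess_tightTriangle_add_le hm1 hmr hms (hε.trans (by norm_num))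
    (FM.crossAt_ne_zero (h𝒯.nondegenerate T hT)) he)
  rw [FM.potential, Finset.sum_eq_zero fun i _ => hedge i, add_zero, ← hV]
  simp only [FM.vertexPotential, Finset.sum_add_distrib]
  congr 1
  rw [Fin.sum_univ_three]
  rfl
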